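/- **Setting.** Agents $1,2,3,\dots$ join a network one after the other. Agent $i$ has the error state $\bar e_i\in\mathbb R^6$ (position and velocity errors in $\mathbb R^3$) and a disturbance $w_i(t)\in\mathbb R^6$. Let $A=\begin{bmatrix}0&I\\0&0\end{bmatrix}$, $B=\begin{bmatrix}0\\I\end{bmatrix}$, $\mathcal S(M)=M+M^\top$, $\|\cdot\|$ the spectral norm, $\mathsf e_{ij}=1$ if $i=j$ and $0$ otherwise. The network of the first $N$ agents has the closed loop $$\dot{\bar e}_i=(A+B\bar L_{ii})\bar e_i+K_{i0}\bar e_i+\sum_{j\le N,\,j\ne i}K_{ij}(\bar e_j-\bar e_i)+w_i,\qquad z_i=\bar e_i,\qquad i=1,\dots,N .$$ **Local problems.** Each agent $i\le N$ has chosen: (1) local controllers: $\tilde P_i>0$, $\tilde L_{ii}$, $\rho_i>0$, $\tilde\nu_i<0$ with $$\begin{bmatrix} I&\tilde P_i&0\\ \tilde P_i&-\mathcal S(A\tilde P_i+B\tilde L_{ii})&-\rho_iI+\tfrac12\tilde P_i\\ 0&-\rho_iI+\tfrac12\tilde P_i&-\tilde\nu_iI\end{bmatrix}>0,$$ and $\nu_i=\tilde\nu_i/\rho_i$,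 $R_i=(\rho_i^{-1}\tilde P_i)^{-1}$, $\bar L_{ii}=\tilde L_{ii}\tilde P_i^{-1}$; (2) $p_i>0$, $\hat\gamma_i<\bar\gamma$, $\varepsilon_i\in\mathbb R$ and the blocks $\{Q^i\}=\{Q_{ii}\}\cup\{Q_{ij},Q_{ji}:j<i\}$, each of the form $\begin{bmatrix}0&0\\q^x&q^v\end{bmatrix}$, with $$\tilde W_{ii}>0,\qquad \mathcal S(R_iQ_{ii})\le p_i\nu_i\varepsilon_iI,\qquad \frac1{\delta_i}\|R_iQ_{ij}\|\le-\frac{p_i\nu_i}{2^j}\quad(j<i),$$ where $\delta_i=\sqrt{\frac{\rho_i+\varepsilon_i-1}{\lambda_{\max}(R_i)}\lambda_{\min}(R_i)}$, $0<\delta_i<1$. The matrices $\tilde W_{ii}$ come from the blocks $$W_{ij}=\begin{bmatrix}\mathsf e_{ij}V_i&0&Q_{ij}&\mathsf e_{ij}V_i\\0&\mathsf e_{ij}I&\mathsf e_{ij}I&0\\Q_{ji}^\top&\mathsf e_{ij}I&-Q_{ji}^\top S_j-S_iQ_{ij}+\mathsf e_{ij}p_i\rho_iI&-\mathsf e_{ij}S_iV_i\\\mathsf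 e_{ij}V_i&0&-\mathsf e_{ij}V_iS_j&\hat\gamma_i\mathsf e_{ij}I\end{bmatrix},\quad V_i=-p_i\nu_iI,\quad S_i=-\tfrac1{2\nu_i}I,$$ by the recursion $\tilde W_i=[\tilde W_{ij}]_{j<i}=[W_{ij}]_{j<i}(\mathcal D_i\mathcal A_i^\top)^{-1}$, $\tilde W_{ii}=W_{ii}-\tilde W_i\mathcal D_i\tilde W_i^\top$, with $\mathcal D_i=\mathrm{diag}(\tilde W_{jj}^{-1})_{j<i}$ and $\mathcal A_i$ the block lower-triangular matrix of the blocks $\tilde W_{kl}$, $l\le k<i$. The gains are $K_{ij}=V_i^{-1}Q_{ij}$. When agent $i$ joins, it sets $K_{i0}=K_{ii}+\sum_{j<i}K_{ij}$, and each earlier agent $j<i$ updates $K_{j0}^{\rm New}=K_{j0}^{\rm Old}+K_{ji}$. **Scalable mesh stability.** A set of networks is *scalable mesh stable* if there are $\beta\in\mathcal{KL}$, $\sigma\in\mathcal K_\infty$ and $c_x,c_w>0$, the same for all networks of the set, such that for all initial states with $\sup_i|\bar e_i(0)|<c_x$ and all measurable bounded disturbances with $\sup_i\|w_i\|_\infty<c_w$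 the solution exists for all $t\ge0$ and $$\sup_i|\bar e_i(t)|\le\beta\big(\sup_i|\bar e_i(0)|,t\big)+\sigma\big(\sup_i\|w_i\|_\infty\big)\qquad(t\ge 0).$$ **Theorem.** (a) Let $N\ge1$ and let agents $1,\dots,N$ satisfy (1) and (2). Then the network of the $N$ agents is finite-gain $L_2$-stable from $w$ to $z$ with some gain $\gamma>0$, $\gamma^2<\bar\gamma$: it is equilibrium-independent dissipative for the supply rate $\gamma^2|w|^2-|z|^2$ with a $C^1$ storage function, and $\|z\|_{L_2}\le\gamma\|w\|_{L_2}+b(\bar e(0))$ with $b(0)=0$. Moreover $\sum_{j<i}\|R_iQ_{ij}\|<-p_i\nu_i\delta_i$ for each $i\le N$, and this network is scalable mesh stable (with constants that may depend on the network). (b) If, in addition, the blocks $Q_{ji}$ designed at agent $i$ obey the same coupling bound in the rows of the earlier agents, $\frac1{\delta_j}\|R_jQ_{ji}\|\le-\frac{p_j\nu_j}{2^i}$ for $j<i\le N$ (so that $\frac1{\delta_i}\|R_iQ_{ij}\|\le-p_i\nu_i/2^j$ for all $j\ne i$), then the centralized mesh stability condition holds: $\sum_{j\le N,\,j\ne i}\|R_iQ_{ij}\|<-p_i\nu_i\delta_i$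 for all $i\le N$. (c) For any $r_{\max}$ and any $r_{\min}>0$, the set of all networks as in (b), of any size $N$ and with any $\bar\gamma$, for which $r_{\min}\le\lambda_{\min}(R_i)$ and $\lambda_{\max}(R_i)\le r_{\max}$ for all agents, is scalable mesh stable: $\beta,\sigma,c_x,c_w$ depend only on $r_{\min},r_{\max}$, not on the number of agents, the topology or the gains. -/

import Mathlib

open scoped Topology
open MeasureTheory

noncomputable section

namespace RigidBodyNetwork

/-! ### Comparison functions -/

/-- Class `𝒦`: continuous and strictly increasing on `[0, ∞)`, vanishing at `0`. -/
def IsClassK (α : ℝ → ℝ) : Prop :=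
  ContinuousOn α (Set.Ici 0) ∧ StrictMonoOn α (Set.Ici 0) ∧ α 0 = 0

/-- Class `𝒦_∞`: class `𝒦` and unbounded. -/
def IsClassKInf (α : ℝ → ℝ) : Prop :=
  IsClassK α ∧ Filter.Tendsto α Filter.atTop Filter.atTop

/-- Class `𝒦ℒ`: class `𝒦` in the first argument, decreasing to `0` in the second one. -/
def IsClassKL (β : ℝ → ℝ → ℝ) : Prop :=
  (∀ t, 0 ≤ t → IsClassK fun r => β r t) ∧
  ∀ r, 0 ≤ r → AntitoneOn (β r) (Set.Ici 0) ∧ Filter.Tendsto (β r) Filter.atTop (𝓝 0)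

/-! ### Input-output systems `ẋ = f(x, u)`, `y = h(x, u)` -/

section Systems

variable {E U Y : Type*} [NormedAddCommGroup E] [NormedSpace ℝ E]
  [NormedAddCommGroup U] [NormedAddCommGroup Y]

/-- `x` is a (Carathéodory) solution on `[0, ∞)` of `ẋ = f(x, u)`, `x(0) = x₀`. -/
def IsSolution (f : E → U → E) (u : ℝ → U) (x₀ : E) (x : ℝ → E) : Prop :=
  ContinuousOn x (Set.Ici 0) ∧
  ∀ t, 0 ≤ t → IntervalIntegrable (fun s => f (x s) (u s)) volume 0 t ∧
    x t = x₀ + ∫ s in (0 : ℝ)..t, f (x s) (u s)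

/-- `L2G(γ)`: equilibrium-independent dissipativity with respect to the supply rate
`γ² |u - u*|² - |y - y*|²`, with a continuously differentiable storage function `V(x, x*)`. -/
def IsL2G (f : E → U → E) (h : E → U → Y) (γ : ℝ) : Prop :=
  ∃ V : E × E → ℝ, ContDiff ℝ 1 V ∧
    ∀ xs us, f xs us = 0 →
      V (xs, xs) = 0 ∧
      (∀ x, x ≠ xs → 0 < V (x, xs)) ∧
      ∀ x u, fderiv ℝ (fun y => V (y, xs)) x (f x u) ≤
        γ ^ 2 * ‖u - us‖ ^ 2 - ‖h x u - h xs us‖ ^ 2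

/-- Finite-gain `ℒ₂`-stability with gain `γ` along trajectories: `‖y‖ ≤ γ ‖u‖ + b(x(0))` for the
norms of `ℒ₂[0, ∞)`, with a bias `b` that vanishes for zero initial state. -/
def HasL2Gain (f : E → U → E) (h : E → U → Y) (γ : ℝ) : Prop :=
  ∃ b : E → ℝ, b 0 = 0 ∧
    ∀ (x₀ : E) (u : ℝ → U) (x : ℝ → E),
      MemLp u 2 (volume.restrict (Set.Ici 0)) → IsSolution f u x₀ x →
      eLpNorm (fun t => h (x t) (u t)) 2 (volume.restrict (Set.Ici 0)) ≤
        ENNReal.ofReal γ * eLpNorm u 2 (volume.restrict (Set.Ici 0)) + ENNReal.ofReal (b x₀)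

end Systems

/-! ### Networks and scalable mesh stability -/

/-- The index set of `ē = (e_x, e_v) ∈ ℝ³ × ℝ³`. -/
abbrev Idx := Fin 3 ⊕ Fin 3

/-- The stacked errors (or disturbances) of `N` agents, with the Euclidean norm. -/
abbrev Stack (N : ℕ) := PiLp 2 fun _ : Fin N => EuclideanSpace ℝ Idx

/-- A network: its number `N` of agents and its closed-loop dynamics `ẋ = F(x, w)`. -/
abbrev Network := Σ N : ℕ, Stack N → Stack N → Stack N

/-- `‖v‖_∞ = sup_{t ≥ 0} |v(t)|`, for bounded `v`. -/
def linfNorm {F : Type*} [NormedAddCommGroup F] (v : ℝ → F) : ℝ :=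
  ⨆ t : Set.Ici (0 : ℝ), ‖v t‖

/-- Scalable mesh stability, around the origin, of a set of networks of any sizes: one choice of
`β`, `σ`, `c_x`, `c_w` works for all of them, in particular regardless of the number of agents. -/
def IsScalableMeshStable (𝒩 : Set Network) : Prop :=
  ∃ (β : ℝ → ℝ → ℝ) (σ : ℝ → ℝ) (cx cw : ℝ),
    IsClassKL β ∧ IsClassKInf σ ∧ 0 < cx ∧ 0 < cw ∧
    ∀ net ∈ 𝒩, ∀ (x₀ : Stack net.1) (w : ℝ → Stack net.1),
      AEStronglyMeasurable w (volume.restrict (Set.Ici 0)) →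
      (∀ i, BddAbove (Set.range fun t : Set.Ici (0 : ℝ) => ‖w t i‖)) →
      (⨆ i, ‖x₀ i‖) < cx →
      (⨆ i, linfNorm fun t => w t i) < cw →
      (∃ x, IsSolution net.2 w x₀ x) ∧
      ∀ x, IsSolution net.2 w x₀ x → ∀ t, 0 ≤ t →
        (⨆ i, ‖x t i‖) ≤ β (⨆ i, ‖x₀ i‖) t + σ (⨆ i, linfNorm fun s => w s i)

/-! ### Sylvester-type decomposition of a block matrix

For a block matrix `W = [W_ij]`, the blocks `W̃_ij`, `j ≤ i`, are computed row by row: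
`W̃_i = [W̃_ij]_{j<i} = W_i (D_i A_iᵀ)⁻¹` and `W̃_ii = W_ii - W̃_i D_i W̃_iᵀ`. -/

section Decomposition

variable {m : Type*} [Fintype m] [DecidableEq m]

/-- `𝒜_i`: the block lower-triangular matrix made of the blocks `T_kl`, `l ≤ k < i`. -/
def lowerFactor (T : ℕ → ℕ → Matrix m m ℝ) (i : ℕ) : Matrix (Fin i × m) (Fin i × m) ℝ :=
  Matrix.of fun a b => if b.1 ≤ a.1 then T a.1 b.1 a.2 b.2 else 0

/-- `𝒟_i = diag(T_jj⁻¹ : j < i)`. -/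
def diagFactor (T : ℕ → ℕ → Matrix m m ℝ) (i : ℕ) : Matrix (Fin i × m) (Fin i × m) ℝ :=
  Matrix.of fun a b => if a.1 = b.1 then (T a.1 a.1)⁻¹ a.2 b.2 else 0

/-- The block row `W_i = [W_ij]_{j < i}`. -/
def rowBlocks (W : ℕ → ℕ → Matrix m m ℝ) (i : ℕ) : Matrix m (Fin i × m) ℝ :=
  Matrix.of fun a b => W i b.1 a b.2

/-- `W̃_i = W_i (𝒟_i 𝒜_iᵀ)⁻¹`, computed from the blocks `T` of the previous rows. -/
def newRow (W T : ℕ → ℕ → Matrix m m ℝ) (i : ℕ) : Matrix m (Fin i × m) ℝ :=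
  rowBlocks W i * (diagFactor T i * (lowerFactor T i).transpose)⁻¹

/-- `W̃_ii = W_ii - W̃_i 𝒟_i W̃_iᵀ`, computed from the blocks `T` of the previous rows. -/
def newDiag (W T : ℕ → ℕ → Matrix m m ℝ) (i : ℕ) : Matrix m m ℝ :=
  W i i - newRow W T i * diagFactor T i * (newRow W T i).transpose

/-- The blocks of the rows `0, …, n - 1` of the decomposition (all other blocks are `0`). -/
def tildeTable (W : ℕ → ℕ → Matrix m m ℝ) : ℕ → ℕ → ℕ → Matrix m m ℝ
  | 0 => fun _ _ => 0
  | n + 1 => Function.update (tildeTable W n) n fun j =>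
      if h : j < n then Matrix.of fun a b => newRow W (tildeTable W n) n a (⟨j, h⟩, b)
      else if j = n then newDiag W (tildeTable W n) n
      else 0

/-- The block `W̃_ij` of the decomposition. -/
def tilde (W : ℕ → ℕ → Matrix m m ℝ) (i j : ℕ) : Matrix m m ℝ :=
  tildeTable W (i + 1) i j

theorem tildeTable_of_lt (W : ℕ → ℕ → Matrix m m ℝ) {n k : ℕ} (h : k < n) :
    tildeTable W n k = tilde W k := by
  induction n with
  | zero => omega
  | succ n ih =>
    rcases Nat.lt_succ_iff_lt_or_eq.mp h with h' | rfl
    · rw [← ih h']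
      simp [tildeTable, Function.update_of_ne h'.ne]
    · rfl

theorem newRow_tildeTable (W : ℕ → ℕ → Matrix m m ℝ) (i : ℕ) :
    newRow W (tildeTable W i) i = newRow W (tilde W) i := by
  have h1 : lowerFactor (tildeTable W i) i = lowerFactor (tilde W) i := by
    ext a b; simp [lowerFactor, tildeTable_of_lt W a.1.2]
  have h2 : diagFactor (tildeTable W i) i = diagFactor (tilde W) i := by
    ext a b; simp [diagFactor, tildeTable_of_lt W a.1.2]
  simp [newRow, h1, h2]

theorem tilde_diag (W : ℕ → ℕ → Matrix m m ℝ) (i : ℕ) :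
    tilde W i i = W i i -
      newRow W (tilde W) i * diagFactor (tilde W) i * (newRow W (tilde W) i).transpose := by
  have h2 : diagFactor (tildeTable W i) i = diagFactor (tilde W) i := by
    ext a b; simp [diagFactor, tildeTable_of_lt W a.1.2]
  simp [tilde, tildeTable, newDiag, newRow_tildeTable, h2]

theorem rowBlocks_tilde (W : ℕ → ℕ → Matrix m m ℝ) (i : ℕ) :
    rowBlocks (tilde W) i = rowBlocks W i *
      (diagFactor (tilde W) i * (lowerFactor (tilde W) i).transpose)⁻¹ := by
  change _ = newRow W (tilde W) i
  ext a b
  simp [rowBlocks, tilde, tildeTable, newRow_tildeTable]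

end Decomposition

/-! ### Matrices of the agents -/

/-- `A = [0 I; 0 0]`. -/
def matA : Matrix Idx Idx ℝ := Matrix.fromBlocks 0 1 0 0

/-- `B = [0; I]`. -/
def matB : Matrix Idx (Fin 3) ℝ := Matrix.fromRows 0 1

/-- `𝒮(M) = M + Mᵀ`. -/
def symPart (M : Matrix Idx Idx ℝ) : Matrix Idx Idx ℝ := M + M.transpose

/-- The spectral norm. -/
def specNorm (M : Matrix Idx Idx ℝ) : ℝ := ‖Matrix.toEuclideanCLM (n := Idx) (𝕜 := ℝ) M‖

/-- The smallest eigenvalue of a symmetric matrix. -/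
def lamMin (M : Matrix Idx Idx ℝ) : ℝ := sInf (spectrum ℝ M)

/-- The largest eigenvalue of a symmetric matrix. -/
def lamMax (M : Matrix Idx Idx ℝ) : ℝ := sSup (spectrum ℝ M)

/-- The quantities chosen at the agents; agent `i ∈ {0, 1, 2, …}` is the `(i+1)`-st one. They are
subject to the constraints collected in `IsFeasible`. -/
structure Design where
  /-- `P̃_i`, of the local control synthesis -/
  Pt : ℕ → Matrix Idx Idx ℝ
  /-- `L̃_ii`, of the local control synthesis -/
  Lt : ℕ → Matrix (Fin 3) Idx ℝ
  /-- `ν̃_i`, of the local control synthesis -/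
  nut : ℕ → ℝ
  /-- `ρ_i`, of the local control synthesis -/
  rho : ℕ → ℝ
  /-- `p_i` -/
  p : ℕ → ℝ
  /-- `ε_i` -/
  eps : ℕ → ℝ
  /-- `γ̂_i` -/
  gamHat : ℕ → ℝ
  /-- `[q_ij^x q_ij^v]`, the lower half of the block `Q_ij` -/
  q : ℕ → ℕ → Matrix (Fin 3) Idx ℝ

namespace Design

variable (D : Design)

/-- `ν_i = ρ_i⁻¹ ν̃_i`. -/
def nu (i : ℕ) : ℝ := (D.rho i)⁻¹ * D.nut i

/-- `R_i = P_i⁻¹` with `P_i = ρ_i⁻¹ P̃_i`. -/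
def R (i : ℕ) : Matrix Idx Idx ℝ := ((D.rho i)⁻¹ • D.Pt i)⁻¹

/-- The local controller gain `L̄_ii = L̃_ii P̃_i⁻¹`. -/
def Lbar (i : ℕ) : Matrix (Fin 3) Idx ℝ := D.Lt i * (D.Pt i)⁻¹

/-- The matrix of the local control synthesis LMI. -/
def localLMI (i : ℕ) : Matrix (Fin 3 × Idx) (Fin 3 × Idx) ℝ :=
  Matrix.comp (Fin 3) (Fin 3) Idx Idx ℝ
    !![1, D.Pt i, 0;
       D.Pt i, -symPart (matA * D.Pt i + matB * D.Lt i),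
         -(D.rho i • (1 : Matrix Idx Idx ℝ)) + (1 / 2 : ℝ) • D.Pt i;
       0, -(D.rho i • (1 : Matrix Idx Idx ℝ)) + (1 / 2 : ℝ) • D.Pt i,
         -(D.nut i • (1 : Matrix Idx Idx ℝ))]

/-- `Q_ij = [0 0; q_ij^x q_ij^v]`. -/
def Q (i j : ℕ) : Matrix Idx Idx ℝ := matB * D.q i j

/-- `V_p^{ii} = -p_i ν_i I`. -/
def Vp (i : ℕ) : Matrix Idx Idx ℝ := (-(D.p i * D.nu i)) • 1

/-- `R_p^{ii} = -p_i ρ_i I`. -/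
def Rp (i : ℕ) : Matrix Idx Idx ℝ := (-(D.p i * D.rho i)) • 1

/-- `S_ii = -(1 / (2 ν_i)) I`. -/
def S (i : ℕ) : Matrix Idx Idx ℝ := (-(1 / (2 * D.nu i))) • 1

/-- The block `W_ij` of the global LMI `W > 0`. -/
def W (i j : ℕ) : Matrix (Fin 4 × Idx) (Fin 4 × Idx) ℝ :=
  let e : ℝ := if i = j then 1 else 0
  Matrix.comp (Fin 4) (Fin 4) Idx Idx ℝ
    !![e • D.Vp i, 0, D.Q i j, e • D.Vp i;
       0, e • 1, e • 1, 0;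
       (D.Q j i).transpose, e • 1,
         -((D.Q j i).transpose * D.S j) - D.S i * D.Q i j - e • D.Rp i, -(e • (D.S i * D.Vp i));
       e • D.Vp i, 0, -(e • (D.Vp i * D.S j)), (D.gamHat i * e) • 1]

/-- `μ_i = (ρ_i + ε_i - 1) / λ_max(R_i)`. -/
def mu (i : ℕ) : ℝ := (D.rho i + D.eps i - 1) / lamMax (D.R i)

/-- `δ_i = √(μ_i λ_min(R_i))`. -/
def delta (i : ℕ) : ℝ := Real.sqrt (D.mu i * lamMin (D.R i))

/-- The first `N` agents, one after the other, have solved their local problems: the local control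
synthesis LMI, and the local co-design problem with global performance bound `γ̄`. -/
structure IsFeasible (gbar : ℝ) (N : ℕ) : Prop where
  Pt_pos : ∀ i < N, (D.Pt i).PosDef
  rho_pos : ∀ i < N, 0 < D.rho i
  nut_neg : ∀ i < N, D.nut i < 0
  local_lmi : ∀ i < N, (D.localLMI i).PosDef
  p_pos : ∀ i < N, 0 < D.p i
  gamHat_lt : ∀ i < N, D.gamHat i < gbar
  tilde_pos : ∀ i < N, (tilde D.W i i).PosDef
  /-- `𝒮(R_i Q_ii) ≤ p_i ν_i ε_i I` -/
  diag_bound : ∀ i < N,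
    ((D.p i * D.nu i * D.eps i) • (1 : Matrix Idx Idx ℝ) - symPart (D.R i * D.Q i i)).PosSemidef
  delta_pos : ∀ i < N, 0 < D.delta i
  delta_lt_one : ∀ i < N, D.delta i < 1
  /-- `‖R_i Q_ij‖ / δ_i ≤ -p_i ν_i / 2^j` for the earlier agents (the weight is `2^(j+1)` as agents
  are counted from `0`) -/
  coupling : ∀ i < N, ∀ j < i,
    specNorm (D.R i * D.Q i j) / D.delta i ≤ -(D.p i * D.nu i) / 2 ^ (j + 1)

/-- The same coupling bound for the blocks `Q_ji`, `j < i`, in the rows of the earlier agents `j`,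
which are designed at agent `i` too. -/
def BackwardCoupling (N : ℕ) : Prop :=
  ∀ i < N, ∀ j < i,
    specNorm (D.R j * D.Q j i) / D.delta j ≤ -(D.p j * D.nu j) / 2 ^ (i + 1)

/-- The interconnection gains `K_ij = (V_p^{ii})⁻¹ Q_ij`. -/
def K (i j : ℕ) : Matrix Idx Idx ℝ := (D.Vp i)⁻¹ * D.Q i j

/-- The gain `K_{j0}` of agent `j` when the first `n` agents have joined. An agent `n` that joins
sets `K_{n0} = K_nn + ∑_{l<n} K_nl`, and asks each earlier agent for
`K_{j0}^New = K_{j0}^Old + K_jn`. -/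
def K0 : ℕ → ℕ → Matrix Idx Idx ℝ
  | 0, _ => 0
  | n + 1, j =>
    if j < n then K0 n j + D.K j n
    else if j = n then D.K n n + ∑ l ∈ Finset.range n, D.K n l
    else 0

/-- The closed-loop error dynamics of the network of the first `N` agents:
`d/dt ē_i = (A + B L̄_ii) ē_i + K_{i0} ē_i + ∑_{j ≠ i} K_ij (ē_j - ē_i) + w_i`. -/
def closedLoop (N : ℕ) (x w : Stack N) : Stack N :=
  WithLp.toLp 2 fun i =>
    Matrix.toEuclideanLin (matA + matB * D.Lbar i) (x i) +
    Matrix.toEuclideanLin (D.K0 N i) (x i) +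
    ∑ j ∈ Finset.univ.erase i, Matrix.toEuclideanLin (D.K i j) (x j - x i) +
    w i

/-- The network of the first `N` agents. -/
def network (N : ℕ) : Network := ⟨N, D.closedLoop N⟩

end Design

/-- The performance output `z = ē`. -/
def output {N : ℕ} (x _w : Stack N) : Stack N := x

end RigidBodyNetwork

end

/-! Everything rests on the energies `xᵢᵀ Rᵢ xᵢ`. By the local LMI, each agent dissipates `xᵀu -
ρ|x|² - ν|u|²` with respect to its total input `u` (`local_dissipation`). The gains `K_{i0}` cancel
the diffusive terms `-K_ij xᵢ`, so the interconnection is simply `uᵢ = ∑ⱼ K_ij xⱼ + wᵢ`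
(`closedLoop_apply`).

Part (a): the recursion for `W̃` is a block factorization `W = 𝒜 𝒟 𝒜ᵀ` with pivots `W̃_ii`. Positive
pivots therefore make the whole form of `W` nonnegative, although no agent ever assembles it
(`sum_dotProduct_block_nonneg`). On vectors `(-u, -x, x, d)` this form is exactly `∑ (γ̂ᵢ|dᵢ|² -
|xᵢ|²)` minus the weighted local supplies (`sum_supply_le`). Hence `∑ pᵢ xᵢᵀ Rᵢ xᵢ` is a storage
function for the gain `γ² = max γ̂ᵢ`. For a fixed finite network it is also an exponential Lyapunov
function, but its constants grow with `N`.

Parts (b) and (c): the row sum condition is a truncated geometric series. Uniformity in `N` needs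
the maximum of normalized energies instead of their sum. With `c = ρ + ε > 1`, the definition of `δ`
and `4(c - 1) ≤ c²` bound the coupling by the decay, with no margin left at `c = 2`; the dyadic row
sums also tend to `1`. A strict margin comes from giving the first agent weight `2/3`: the weighted
row sums are then at most `5/6` of the weight, whatever `N` (`sum_erase_weight_div_le`).
`agent_decay` and the comparison principle `lt_exp_of_deriv_le_max` turn this into a uniform
exponential bound. -/

noncomputable section

namespace RigidBodyNetwork

/-! ### Absolute continuity, scalar comparison and existence for linear equations -/

section Analysis

theorem absolutelyContinuousOnInterval_sum {ι : Type*} (s : Finset ι) {f : ι → ℝ → ℝ} {a b : ℝ}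
    (h : ∀ i ∈ s, AbsolutelyContinuousOnInterval (f i) a b) :
    AbsolutelyContinuousOnInterval (fun t => ∑ i ∈ s, f i t) a b := by
  classical
  induction s using Finset.induction_on with
  | empty =>
    simpa using (contDiffOn_const (c := (0 : ℝ)) (𝕜 := ℝ) (s := Set.uIcc a b)
      (n := 1)).absolutelyContinuousOnInterval
  | insert i s hi ih =>
    simp only [Finset.sum_insert hi]
    exact (h i (by simp)).add (ih fun j hj => h j (by simp [hj]))

variable {E : Type*} [NormedAddCommGroup E] [NormedSpace ℝ E]

/-- The function `t ↦ x₀ + ∫₀ᵗ g`. -/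
def primitive (x₀ : E) (g : ℝ → E) (t : ℝ) : E := x₀ + ∫ s in (0 : ℝ)..t, g s

theorem absolutelyContinuous_apply_primitive [CompleteSpace E] (x₀ : E) {g : ℝ → E} {T : ℝ}
    (hg : IntervalIntegrable g volume 0 T) (l : E →L[ℝ] ℝ) :
    AbsolutelyContinuousOnInterval (fun t => l (primitive x₀ g t)) 0 T := by
  have h1 : IntervalIntegrable (fun s => l (g s)) volume 0 T :=
    ⟨l.integrable_comp hg.1, l.integrable_comp hg.2⟩
  have h2 : AbsolutelyContinuousOnInterval (fun t => l x₀ + ∫ s in (0 : ℝ)..t, l (g s)) 0 T :=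
    ((contDiffOn_const (c := l x₀) (𝕜 := ℝ) (s := Set.uIcc 0 T)
      (n := 1)).absolutelyContinuousOnInterval).add
      (h1.absolutelyContinuousOnInterval_intervalIntegral (by simp))
  rw [absolutelyContinuousOnInterval_iff] at h2 ⊢
  intro ε hε
  obtain ⟨δ, hδ, h⟩ := h2 ε hε
  -- Integrability of `g` is known only on `[0, T]`, so `l` commutes with the integral only there.
  -- The two functions need not agree outside, and the ε-δ definition is transferred on the
  -- interval.
  refine ⟨δ, hδ, fun I hI hI' => ?_⟩
  have key : ∀ t ∈ Set.uIcc 0 T, l (primitive x₀ g t) = l x₀ + ∫ s in (0 : ℝ)..t, l (g s) := by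
    intro t ht
    rw [primitive, map_add, ← l.intervalIntegral_comp_comm]
    exact hg.mono_set (Set.uIcc_subset_uIcc_left ht)
  refine lt_of_le_of_lt (le_of_eq (Finset.sum_congr rfl fun i hi => ?_)) (h I hI hI')
  rw [key _ (hI.1 i hi).1, key _ (hI.1 i hi).2]

/-- Expanding one argument in a basis leaves a finite sum of products of linear functionals of the
trajectory, and products of absolutely continuous scalar functions are absolutely continuous. -/
theorem absolutelyContinuous_quadratic [FiniteDimensional ℝ E] (x₀ : E) {g : ℝ → E} {T : ℝ}
    (hg : IntervalIntegrable g volume 0 T) (B : E →L[ℝ] E →L[ℝ] ℝ) :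
    AbsolutelyContinuousOnInterval
      (fun t => B (primitive x₀ g t) (primitive x₀ g t)) 0 T := by
  have : CompleteSpace E := FiniteDimensional.complete ℝ E
  let b := Module.finBasis ℝ E
  have h : (fun t => B (primitive x₀ g t) (primitive x₀ g t)) = fun t =>
      ∑ k, LinearMap.toContinuousLinearMap (b.coord k) (primitive x₀ g t) *
        B (b k) (primitive x₀ g t) := by
    funext t
    have : B (primitive x₀ g t) (primitive x₀ g t) =
        B (∑ k, b.repr (primitive x₀ g t) k • b k) (primitive x₀ g t) := by rw [b.sum_repr]
    rw [this]
    simp only [map_sum, map_smul, sum_apply, smul_apply, smul_eq_mul]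
    rfl
  rw [h]
  exact absolutelyContinuousOnInterval_sum _ fun k _ =>
    (absolutelyContinuous_apply_primitive x₀ hg _).fun_mul
      (absolutelyContinuous_apply_primitive x₀ hg _)

theorem ae_hasDerivAt_quadratic [CompleteSpace E] (x₀ : E) {g : ℝ → E} {T : ℝ} (hT : 0 ≤ T)
    (hg : IntervalIntegrable g volume 0 T) (B : E →L[ℝ] E →L[ℝ] ℝ) :
    ∀ᵐ t, t ∈ Set.Icc 0 T → HasDerivAt (fun t => B (primitive x₀ g t) (primitive x₀ g t))
      (B (primitive x₀ g t) (g t) + B (g t) (primitive x₀ g t)) t := by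
  filter_upwards [hg.ae_hasDerivAt_integral] with t ht htT
  rw [Set.uIcc_of_le hT] at ht
  have h1 : HasDerivAt (primitive x₀ g) (g t) t := by
    exact (ht htT 0 ⟨le_rfl, hT⟩).const_add x₀
  have h2 := B.hasFDerivAt_of_bilinear h1.hasFDerivAt h1.hasFDerivAt
  simpa using h2.hasDerivAt

/-- Comparison with a scalar linear differential equation. -/
theorem le_exp_mul_of_deriv_le {D : ℝ → ℝ} {b T : ℝ} (hT : 0 ≤ T)
    (hD : AbsolutelyContinuousOnInterval D 0 T)
    (h : ∀ᵐ t, t ∈ Set.Icc 0 T → deriv D t ≤ -b * D t) : D T ≤ Real.exp (-(b * T)) * D 0 := by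
  -- Integrating factor: `exp (b t) * D t` has nonpositive derivative almost everywhere, and
  -- absolute continuity permits integrating it.
  have hE : AbsolutelyContinuousOnInterval (fun t => Real.exp (b * t)) 0 T :=
    ContDiffOn.absolutelyContinuousOnInterval (by fun_prop)
  have h1 := AbsolutelyContinuousOnInterval.integral_deriv_mul_eq_sub hE hD
  have hd : ∀ t, deriv (fun t => Real.exp (b * t)) t = Real.exp (b * t) * b := by
    intro t
    have : HasDerivAt (fun t => Real.exp (b * t)) (Real.exp (b * t) * (b * 1)) t :=
      ((hasDerivAt_id t).const_mul b).exp
    simpa using this.deriv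
  have h2 : ∫ x in (0 : ℝ)..T, deriv (fun t => Real.exp (b * t)) x * D x +
      Real.exp (b * x) * deriv D x ≤ 0 := by
    rw [intervalIntegral.integral_of_le hT]
    refine integral_nonpos_of_ae ?_
    rw [Filter.EventuallyLE, ae_restrict_iff' measurableSet_Ioc]
    filter_upwards [h] with t ht htT
    have := ht ⟨htT.1.le, htT.2⟩
    rw [hd]
    have h3 := mul_le_mul_of_nonneg_left this (Real.exp_pos (b * t)).le
    simp only [Pi.zero_apply]
    nlinarith
  rw [h1] at h2
  simp only [mul_zero, Real.exp_zero, one_mul] at h2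
  have h4 : D T = Real.exp (-(b * T)) * (Real.exp (b * T) * D T) := by
    rw [← mul_assoc, ← Real.exp_add]; simp
  rw [h4]
  exact mul_le_mul_of_nonneg_left (by linarith) (Real.exp_pos _).le

/-- A comparison principle for the maximum of finitely many functions. -/
theorem lt_exp_of_deriv_le_max {ι : Type*} [Fintype ι] {φ : ι → ℝ → ℝ} {a b : ι → ℝ}
    {α κ c : ℝ} (hα : 0 < α) (hκ : 0 ≤ κ) (hc : 0 ≤ c) (hab : ∀ i, a i + α ≤ b i)
    (hAC : ∀ i T, 0 ≤ T → AbsolutelyContinuousOnInterval (φ i) 0 T)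
    (hφ : ∀ i T, 0 ≤ T → ∀ᵐ t, t ∈ Set.Icc 0 T →
      DifferentiableAt ℝ (φ i) t ∧
      ∀ m, (∀ j, φ j t ≤ m) → deriv (φ i) t ≤ -b i * φ i t + a i * m + κ)
    (h0 : ∀ i, φ i 0 < c) {t : ℝ} (ht : 0 ≤ t) (i : ι) :
    φ i t < c * Real.exp (-(α * t)) + κ / α := by
  set M : ℝ → ℝ := fun t => c * Real.exp (-(α * t)) + κ / α with hM
  have hM0 : ∀ t, 0 ≤ M t := fun t => by positivity
  have hMd : ∀ t, HasDerivAt M (-α * (M t - κ / α)) t := by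
    intro t
    have : HasDerivAt (fun t => Real.exp (-(α * t))) (Real.exp (-(α * t)) * -(α * 1)) t :=
      (((hasDerivAt_id t).const_mul α).neg).exp
    convert! (this.const_mul c).add_const (κ / α) using 1
    simp only [hM]; ring
  have hMc : ContDiff ℝ 1 M := by fun_prop
  by_contra hcon
  rw [not_lt] at hcon
  have hcont : ∀ j, ContinuousOn (φ j) (Set.Icc 0 t) := fun j => by
    simpa [Set.uIcc_of_le ht] using (hAC j t ht).continuousOn
  -- The times at which some `φ j` has reached the barrier `M` form a compact set; its least element
  -- `t₁` is the first contact.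
  let S : Set ℝ := ⋃ j, {s ∈ Set.Icc 0 t | M s ≤ φ j s}
  have hS : IsCompact S := by
    refine isCompact_iUnion fun j => ?_
    refine isCompact_Icc.of_isClosed_subset ?_ (Set.sep_subset _ _)
    exact isClosed_Icc.isClosed_le hMc.continuous.continuousOn (hcont j)
  have hne : S.Nonempty := ⟨t, Set.mem_iUnion.2 ⟨i, ⟨ht, le_rfl⟩, hcon⟩⟩
  obtain ⟨t₁, ht₁, hmin⟩ := hS.exists_isLeast hne
  obtain ⟨j, ⟨ht₁0, ht₁t⟩, hj⟩ := Set.mem_iUnion.1 ht₁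
  have hlt : ∀ s, 0 ≤ s → s < t₁ → ∀ k, φ k s < M s := by
    intro s hs0 hs k
    by_contra hk
    rw [not_lt] at hk
    exact absurd (hmin (Set.mem_iUnion.2 ⟨k, ⟨hs0, hs.le.trans ht₁t⟩, hk⟩)) (not_le.2 hs)
  have hne1 : ∀ᵐ s : ℝ, s ≠ t₁ := by simp [ae_iff, measure_singleton]
  have hD : AbsolutelyContinuousOnInterval (fun s => φ j s - M s) 0 t₁ :=
    (hAC j t₁ ht₁0).sub (ContDiffOn.absolutelyContinuousOnInterval hMc.contDiffOn)
  -- Before `t₁` all functions lie below `M`, so `m = M s` is admissible. As `M' = -α M + κ`, `M ≥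
  -- 0` and `a j + α ≤ b j`, the difference satisfies `(φ j - M)' ≤ -b j (φ j - M)`. It starts
  -- negative, so it cannot be nonnegative at `t₁`.
  have key := le_exp_mul_of_deriv_le (b := b j) ht₁0 hD (by
    filter_upwards [hφ j t₁ ht₁0, hne1] with s hs hs1 hsI
    obtain ⟨hd, hs⟩ := hs hsI
    have hle := hs (M s) fun k => (hlt s hsI.1 (lt_of_le_of_ne hsI.2 hs1) k).le
    have : deriv (fun s => φ j s - M s) s = deriv (φ j) s - -α * (M s - κ / α) :=
      (hd.hasDerivAt.sub (hMd s)).deriv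
    rw [this]
    have h2 : α * (κ / α) = κ := by field_simp
    nlinarith [mul_le_mul_of_nonneg_right (hab j) (hM0 s)])
  have h3 : φ j 0 - M 0 < 0 := by
    have : M 0 = c + κ / α := by simp [hM]
    have := div_nonneg hκ hα.le
    linarith [h0 j]
  have h4 := mul_neg_of_pos_of_neg (Real.exp_pos (-(b j * t₁))) h3
  linarith

/-- Existence of solutions of `ẋ = A x + w`. -/
theorem exists_linear_solution [FiniteDimensional ℝ E] (A : E →L[ℝ] E) (w : ℝ → E) (x₀ : E)
    (hw : ∀ t, 0 ≤ t → IntervalIntegrable w volume 0 t) :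
    ∃ x, IsSolution (fun x w => A x + w) w x₀ x := by
  have : CompleteSpace E := FiniteDimensional.complete ℝ E
  -- Nothing is known of `w` at negative times; extension by zero makes its primitive `y` continuous
  -- on all of `ℝ`.
  set w' : ℝ → E := fun t => if 0 ≤ t then w t else 0 with hw'
  have hwi : ∀ t, IntervalIntegrable w' volume 0 t := by
    intro t
    rcases le_total 0 t with ht | ht
    · refine (hw t ht).congr_ae ?_
      rw [Set.uIoc_of_le ht]
      refine (ae_restrict_iff' measurableSet_Ioc).2 (Filter.Eventually.of_forall fun s hs => ?_)
      simp [hw', hs.1.le]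
    · refine (intervalIntegrable_const (c := (0 : E))).congr_ae ?_
      rw [Set.uIoc_of_ge ht]
      have : ∀ᵐ s : ℝ, s ≠ 0 := by simp [ae_iff, measure_singleton]
      refine (ae_restrict_iff' measurableSet_Ioc).2 ?_
      filter_upwards [this] with s hs hsI
      simp [hw', not_le.2 (lt_of_le_of_ne hsI.2 hs)]
  let _ : NormedAlgebra ℚ (E →L[ℝ] E) := NormedAlgebra.restrictScalars ℚ ℝ _
  set y : ℝ → E := fun t => x₀ + ∫ s in (0 : ℝ)..t, w' s with hy
  have hyc : Continuous y := by
    refine continuous_const.add (intervalIntegral.continuous_primitive (fun a b => ?_) 0)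
    exact (hwi a).symm.trans (hwi b)
  set e : ℝ → (E →L[ℝ] E) := fun t => NormedSpace.exp (t • A) with he
  have hed : ∀ t, HasDerivAt e (A * e t) t := fun t => by
    simpa using hasDerivAt_exp_smul_const' (𝕂 := ℝ) A t
  have hec : Continuous e := continuous_iff_continuousAt.2 fun t => (hed t).continuousAt
  have hinv : ∀ t, e t * e (-t) = 1 := by
    intro t
    simp only [he]
    rw [neg_smul, ← NormedSpace.exp_add_of_commute ((Commute.refl (t • A)).neg_right)]
    simp
  set q : ℝ → E := fun t => ∫ s in (0 : ℝ)..t, e (-s) (A (y s)) with hq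
  have hqc : Continuous fun s => e (-s) (A (y s)) := by fun_prop
  -- Variation of constants for `ż = A (y + z)`, `z 0 = 0`. Its forcing `A y` is continuous, so `z`
  -- is differentiable everywhere; the merely integrable `w` enters only through `y`, and the
  -- solution is `y + z`.
  set z : ℝ → E := fun t => e t (q t) with hz
  have hzd : ∀ t, HasDerivAt z (A (y t + z t)) t := by
    intro t
    have h1 : HasDerivAt q (e (-t) (A (y t))) t :=
      intervalIntegral.integral_hasDerivAt_right (hqc.intervalIntegrable _ _)
        (hqc.stronglyMeasurableAtFilter _ _) hqc.continuousAt
    have h2 := (hed t).clm_apply h1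
    convert! h2 using 1
    have h3 : e t (e (-t) (A (y t))) = A (y t) := by
      rw [← mul_apply_eq_comp, hinv]; rfl
    rw [h3]
    simp [hz, add_comm]
  have hzc : Continuous z := continuous_iff_continuousAt.2 fun t => (hzd t).continuousAt
  have hAc : Continuous fun s => A (y s + z s) := by fun_prop
  refine ⟨fun t => y t + z t, (hyc.add hzc).continuousOn, fun t ht => ?_⟩
  have hi1 : IntervalIntegrable (fun s => A (y s + z s)) volume 0 t := hAc.intervalIntegrable _ _
  refine ⟨hi1.add (hw t ht), ?_⟩
  rw [intervalIntegral.integral_add hi1 (hw t ht),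
    intervalIntegral.integral_eq_sub_of_hasDerivAt (fun s _ => hzd s) hi1]
  have h0 : z 0 = 0 := by simp [hz, hq]
  have h1 : ∫ s in (0 : ℝ)..t, w' s = ∫ s in (0 : ℝ)..t, w s := by
    refine intervalIntegral.integral_congr fun s hs => ?_
    rw [Set.uIcc_of_le ht] at hs
    simp [hw', hs.1]
  simp only [hy, h1, h0]
  abel

/-- Existence of solutions of a linear system, with the disturbance as an additive input. -/
theorem exists_solution [FiniteDimensional ℝ E] {f : E → E → E}
    (hadd : ∀ x y v w, f (x + y) (v + w) = f x v + f y w)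
    (hsmul : ∀ (c : ℝ) x w, f (c • x) (c • w) = c • f x w) (hzero : ∀ w, f 0 w = w)
    (w : ℝ → E) (x₀ : E) (hw : ∀ t, 0 ≤ t → IntervalIntegrable w volume 0 t) :
    ∃ x, IsSolution f w x₀ x := by
  let A : E →ₗ[ℝ] E :=
    { toFun := fun x => f x 0
      map_add' := fun x y => by rw [← hadd, add_zero]
      map_smul' := fun c x => by rw [RingHom.id_apply, ← hsmul, smul_zero] }
  have hf : f = fun x w => LinearMap.toContinuousLinearMap A x + w := by
    funext x w
    have := hadd x 0 0 w
    rw [add_zero, zero_add, hzero] at this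
    exact this
  rw [hf]
  exact exists_linear_solution _ w x₀ hw

end Analysis

/-! ### The block factorization behind the recursion for `W̃` -/

section BlockFactorization

open Matrix

variable {m : Type*} [Fintype m] [DecidableEq m]

theorem isUnit_det_lowerFactor (T : ℕ → ℕ → Matrix m m ℝ) {i : ℕ}
    (h : ∀ k < i, IsUnit (T k k).det) : IsUnit (lowerFactor T i).det := by
  have ht : (lowerFactor T i)ᵀ.BlockTriangular Prod.fst := by
    intro a b hab
    simp [lowerFactor, not_le.2 hab]
  rw [← det_transpose, ht.det_fintype, IsUnit.prod_univ_iff]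
  intro k
  let e : m ≃ {a : Fin i × m // a.1 = k} :=
    { toFun := fun c => ⟨(k, c), rfl⟩
      invFun := fun a => a.1.2
      left_inv := fun c => rfl
      right_inv := by rintro ⟨⟨k, c⟩, rfl⟩; rfl }
  have : ((lowerFactor T i)ᵀ.toSquareBlock Prod.fst k).submatrix e e = (T k k)ᵀ := by
    ext c d
    simp [e, toSquareBlock_def, lowerFactor]
  rw [← det_submatrix_equiv_self e, this, det_transpose]
  exact h k k.2

theorem isUnit_det_diagFactor (T : ℕ → ℕ → Matrix m m ℝ) {i : ℕ}
    (h : ∀ k < i, IsUnit (T k k).det) : IsUnit (diagFactor T i).det := by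
  have : diagFactor T i * Matrix.of (fun a b : Fin i × m => if a.1 = b.1 then
      (T a.1 a.1) a.2 b.2 else 0) = 1 := by
    ext ⟨k, c⟩ ⟨l, d⟩
    have h1 := congrFun (congrFun (nonsing_inv_mul (T k k) (h k k.2)) c) d
    rw [mul_apply] at h1
    simp only [mul_apply, diagFactor, of_apply, Fintype.sum_prod_type, ite_mul, zero_mul]
    rw [Finset.sum_eq_single k]
    · by_cases hkl : k = l
      · subst hkl; simp [h1, one_apply]
      · simp [hkl, one_apply]
    · intro b _ hb; simp [hb.symm]
    · simp
  exact isUnit_det_of_right_inverse this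

/-- The block `(k, j)` of the block upper-triangular factor `𝒜ᵀ`. -/
def upperBlock (T : ℕ → ℕ → Matrix m m ℝ) (k j : ℕ) : Matrix m m ℝ :=
  if k ≤ j then (T j k)ᵀ else 0

theorem rowBlocks_mul_diagFactor_apply (T : ℕ → ℕ → Matrix m m ℝ) (i : ℕ) (a : m) (k : Fin i)
    (c : m) : (rowBlocks T i * diagFactor T i) a (k, c) = (T i k * (T k k)⁻¹) a c := by
  simp only [mul_apply, rowBlocks, diagFactor, of_apply, Fintype.sum_prod_type, mul_ite, mul_zero]
  rw [Finset.sum_eq_single k]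
  · simp
  · intro b _ hb; simp [hb]
  · simp

theorem rowBlocks_mul_mul_transpose_lowerFactor (T : ℕ → ℕ → Matrix m m ℝ) (i : ℕ) (a b : m)
    (j : Fin i) : (rowBlocks T i * diagFactor T i * (lowerFactor T i)ᵀ) a (j, b) =
      (∑ k ∈ Finset.range i, T i k * (T k k)⁻¹ * upperBlock T k j) a b := by
  rw [mul_apply, Fintype.sum_prod_type, Matrix.sum_apply, ← Fin.sum_univ_eq_sum_range
    (fun k => (T i k * (T k k)⁻¹ * upperBlock T k j) a b)]
  refine Finset.sum_congr rfl fun k _ => ?_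
  rw [mul_apply]
  refine Finset.sum_congr rfl fun c _ => ?_
  rw [rowBlocks_mul_diagFactor_apply]
  by_cases h : k ≤ j
  · simp [lowerFactor, upperBlock, h]
  · have : ¬ (k : ℕ) ≤ j := h
    simp [lowerFactor, upperBlock, h, this]

theorem rowBlocks_mul_mul_transpose_rowBlocks (T : ℕ → ℕ → Matrix m m ℝ) (i : ℕ) :
    rowBlocks T i * diagFactor T i * (rowBlocks T i)ᵀ =
      ∑ k ∈ Finset.range i, T i k * (T k k)⁻¹ * (T i k)ᵀ := by
  ext a b
  rw [mul_apply, Fintype.sum_prod_type, Matrix.sum_apply, ← Fin.sum_univ_eq_sum_range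
    (fun k => (T i k * (T k k)⁻¹ * (T i k)ᵀ) a b)]
  refine Finset.sum_congr rfl fun k _ => ?_
  rw [mul_apply]
  refine Finset.sum_congr rfl fun c _ => ?_
  rw [rowBlocks_mul_diagFactor_apply]
  simp [rowBlocks]

variable {W : ℕ → ℕ → Matrix m m ℝ}

/-- The recursion multiplies by a matrix inverse, which is a true inverse only if the earlier pivots
are invertible. Their positivity ensures this, and the recursion can be undone. -/
theorem rowBlocks_eq_mul (i : ℕ) (h : ∀ k < i, (tilde W k k).PosDef) :
    rowBlocks W i = rowBlocks (tilde W) i * diagFactor (tilde W) i *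
      (lowerFactor (tilde W) i)ᵀ := by
  have hu : ∀ k < i, IsUnit (tilde W k k).det := fun k hk => (h k hk).det_pos.ne'.isUnit
  rw [rowBlocks_tilde, Matrix.mul_assoc, Matrix.mul_assoc, nonsing_inv_mul, Matrix.mul_one]
  rw [det_mul, det_transpose]
  exact (isUnit_det_diagFactor _ hu).mul (isUnit_det_lowerFactor _ hu)

theorem newRow_tilde (W : ℕ → ℕ → Matrix m m ℝ) (i : ℕ) :
    newRow W (tilde W) i = rowBlocks (tilde W) i := (rowBlocks_tilde W i).symm

theorem diag_eq_sum_tilde (W : ℕ → ℕ → Matrix m m ℝ) (i : ℕ) : W i i = tilde W i i +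
    ∑ k ∈ Finset.range i, tilde W i k * (tilde W k k)⁻¹ * (tilde W i k)ᵀ := by
  rw [← rowBlocks_mul_mul_transpose_rowBlocks, ← newRow_tilde]
  rw [tilde_diag W i, sub_add_cancel]

/-- The factorization `W = 𝒜 𝒟 𝒜ᵀ`, blockwise on and below the diagonal. -/
theorem block_eq_sum_tilde {n i j : ℕ} (hi : i < n) (hji : j ≤ i)
    (h : ∀ k < n, (tilde W k k).PosDef) :
    W i j = ∑ k ∈ Finset.range n,
      (upperBlock (tilde W) k i)ᵀ * (tilde W k k)⁻¹ * upperBlock (tilde W) k j := by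
  rcases hji.lt_or_eq with hj | rfl
  · have h1 : W i j = ∑ k ∈ Finset.range i,
        tilde W i k * (tilde W k k)⁻¹ * upperBlock (tilde W) k j := by
      ext a b
      have h2 := congrFun (congrFun (rowBlocks_eq_mul i fun k hk => h k (hk.trans hi)) a)
        (⟨j, hj⟩, b)
      rw [rowBlocks_mul_mul_transpose_lowerFactor] at h2
      simpa [rowBlocks] using h2
    rw [h1, ← Finset.sum_subset (Finset.range_mono hi.le)]
    · refine Finset.sum_congr rfl fun k hk => ?_
      rw [upperBlock, upperBlock, if_pos (Finset.mem_range.1 hk).le, transpose_transpose]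
    · intro k _ hk
      have : ¬ k ≤ j := by simp at hk; omega
      simp [upperBlock, this]
  · rw [diag_eq_sum_tilde W, ← Finset.sum_subset (Finset.range_mono (Nat.succ_le_of_lt hi)),
      Finset.sum_range_succ, add_comm]
    · congr 1
      · refine Finset.sum_congr rfl fun k hk => ?_
        rw [upperBlock, if_pos (Finset.mem_range.1 hk).le, transpose_transpose]
      · rw [upperBlock, if_pos le_rfl, transpose_transpose, mul_nonsing_inv _
          (h j hi).det_pos.ne'.isUnit, Matrix.one_mul]
        simpa using (h j hi).isHermitian.eq.symm
    · intro k _ hk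
      have : ¬ k ≤ j := by simp at hk; omega
      simp [upperBlock, this]

theorem block_eq_sum_tilde_of_symm {n i j : ℕ} (hi : i < n) (hj : j < n)
    (hW : ∀ i j, (W i j)ᵀ = W j i) (h : ∀ k < n, (tilde W k k).PosDef) :
    W i j = ∑ k ∈ Finset.range n,
      (upperBlock (tilde W) k i)ᵀ * (tilde W k k)⁻¹ * upperBlock (tilde W) k j := by
  rcases le_total j i with hji | hij
  · exact block_eq_sum_tilde hi hji h
  · rw [← hW, block_eq_sum_tilde hj hij h, transpose_sum]
    refine Finset.sum_congr rfl fun k hk => ?_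
    have := (h k (Finset.mem_range.1 hk)).inv.isHermitian.eq
    rw [conjTranspose_eq_transpose_of_trivial] at this
    rw [transpose_mul, transpose_mul, transpose_transpose, this, Matrix.mul_assoc]

/-- With `ηₖ = ∑ᵢ (𝒜ᵀ)ₖᵢ vᵢ` the factorization turns the form into `∑ₖ ηₖᵀ W̃ₖₖ⁻¹ ηₖ`, a sum of
nonnegative terms. -/
theorem sum_dotProduct_block_nonneg {n : ℕ} (hW : ∀ i j, (W i j)ᵀ = W j i)
    (h : ∀ k < n, (tilde W k k).PosDef) (v : ℕ → m → ℝ) :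
    0 ≤ ∑ i ∈ Finset.range n, ∑ j ∈ Finset.range n, v i ⬝ᵥ (W i j *ᵥ v j) := by
  have : ∑ i ∈ Finset.range n, ∑ j ∈ Finset.range n, v i ⬝ᵥ (W i j *ᵥ v j) =
      ∑ k ∈ Finset.range n, (∑ i ∈ Finset.range n, upperBlock (tilde W) k i *ᵥ v i) ⬝ᵥ
        ((tilde W k k)⁻¹ *ᵥ ∑ j ∈ Finset.range n, upperBlock (tilde W) k j *ᵥ v j) := by
    simp only [mulVec_sum, sum_dotProduct, dotProduct_sum]
    symm
    rw [Finset.sum_congr rfl fun k _ => Finset.sum_comm, Finset.sum_comm]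
    refine Finset.sum_congr rfl fun i hi => ?_
    rw [Finset.sum_comm]
    refine Finset.sum_congr rfl fun j hj => ?_
    rw [block_eq_sum_tilde_of_symm (Finset.mem_range.1 hi) (Finset.mem_range.1 hj) hW h,
      sum_mulVec, dotProduct_sum]
    refine Finset.sum_congr rfl fun k _ => ?_
    rw [← mulVec_mulVec, ← mulVec_mulVec, dotProduct_mulVec (v i), vecMul_transpose]
  rw [this]
  refine Finset.sum_nonneg fun k hk => ?_
  simpa using (h k (Finset.mem_range.1 hk)).inv.posSemidef.dotProduct_mulVec_nonneg _

theorem posDef_diag_of_tilde {i : ℕ} (h : ∀ k ≤ i, (tilde W k k).PosDef) : (W i i).PosDef := by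
  rw [diag_eq_sum_tilde W]
  refine (h i le_rfl).add_posSemidef (posSemidef_sum _ fun k hk => ?_)
  simpa using (h k (Finset.mem_range.1 hk).le).inv.posSemidef.mul_mul_conjTranspose_same _

end BlockFactorization

/-! ### From the local and global LMIs to dissipation inequalities -/

section Dissipation

open Matrix

theorem dotProduct_comp_mulVec {ι m : Type*} [Fintype ι] [Fintype m]
    (M : Matrix ι ι (Matrix m m ℝ)) (u v : ι → m → ℝ) :
    (fun p : ι × m => u p.1 p.2) ⬝ᵥ (Matrix.comp ι ι m m ℝ M *ᵥ fun p => v p.1 p.2) =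
      ∑ i, ∑ j, u i ⬝ᵥ (M i j *ᵥ v j) := by
  simp only [dotProduct, mulVec, Fintype.sum_prod_type, Matrix.comp_apply, Finset.mul_sum]
  refine Finset.sum_congr rfl fun i _ => ?_
  rw [Finset.sum_comm]

theorem dotProduct_transpose_mulVec {m : Type*} [Fintype m] (M : Matrix m m ℝ) (u v : m → ℝ) :
    u ⬝ᵥ (Mᵀ *ᵥ v) = (M *ᵥ u) ⬝ᵥ v := by
  rw [dotProduct_mulVec, vecMul_transpose]

theorem transpose_comp_eq {ι m : Type*} {M M' : Matrix ι ι (Matrix m m ℝ)}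
    (h : ∀ p q, (M p q)ᵀ = M' q p) :
    (Matrix.comp ι ι m m ℝ M)ᵀ = Matrix.comp ι ι m m ℝ M' := by
  ext a b
  exact congrFun (congrFun (h b.1 a.1) a.2) b.2

namespace Design

variable {D : Design} {i : ℕ}

theorem R_eq_smul (hP : (D.Pt i).PosDef) (hρ : 0 < D.rho i) : D.R i = D.rho i • (D.Pt i)⁻¹ := by
  rw [R]
  refine inv_eq_left_inv ?_
  rw [Matrix.smul_mul, Matrix.mul_smul, smul_smul, nonsing_inv_mul _ hP.det_pos.ne'.isUnit,
    mul_inv_cancel₀ hρ.ne', one_smul]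

theorem posDef_R (hP : (D.Pt i).PosDef) (hρ : 0 < D.rho i) : (D.R i).PosDef :=
  (hP.smul (inv_pos.2 hρ)).inv

/-- Local dissipativity: the storage function `xᵀ R x` certifies the supply rate
`xᵀ u - ρ |x|² - ν |u|²`. -/
theorem local_dissipation (hP : (D.Pt i).PosDef) (hρ : 0 < D.rho i)
    (hL : (D.localLMI i).PosDef) (x c : Idx → ℝ) :
    2 * ((D.R i *ᵥ x) ⬝ᵥ ((matA + matB * D.Lbar i) *ᵥ x + c)) ≤
      x ⬝ᵥ c - D.rho i * (x ⬝ᵥ x) - D.nu i * (c ⬝ᵥ c) := by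
  set ξ : Idx → ℝ := (D.Pt i)⁻¹ *ᵥ x with hξ
  have hu : IsUnit (D.Pt i).det := hP.det_pos.ne'.isUnit
  have hPξ : D.Pt i *ᵥ ξ = x := by simp [hξ, mulVec_mulVec, mul_nonsing_inv _ hu]
  have hRx : D.R i *ᵥ x = D.rho i • ξ := by rw [R_eq_smul hP hρ, smul_mulVec]
  have hPt : (D.Pt i)ᵀ = D.Pt i := by simpa using hP.isHermitian.eq
  have hξP : ∀ z, ξ ⬝ᵥ (D.Pt i *ᵥ z) = x ⬝ᵥ z := by
    intro z; rw [← hPt, dotProduct_transpose_mulVec, hPξ]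
  have hN : (matA * D.Pt i + matB * D.Lt i) *ᵥ ξ = (matA + matB * D.Lbar i) *ᵥ x := by
    rw [add_mulVec, ← mulVec_mulVec, hPξ, add_mulVec, hξ, mulVec_mulVec, Lbar, Matrix.mul_assoc]
  have hS : ξ ⬝ᵥ (symPart (matA * D.Pt i + matB * D.Lt i) *ᵥ ξ) =
      2 * (ξ ⬝ᵥ ((matA + matB * D.Lbar i) *ᵥ x)) := by
    rw [symPart, add_mulVec, dotProduct_add, dotProduct_transpose_mulVec, hN, dotProduct_comm _ ξ]
    ring
  -- The test vector is `(-x, P̃⁻¹x, ρ⁻¹c)`. The first entry minimizes the form over the identity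
  -- block, which is a Schur complement and leaves `-|x|²`. Multiplying by `ρ` then gives the claim,
  -- since `R x = ρ P̃⁻¹ x`.
  have key := hL.posSemidef.dotProduct_mulVec_nonneg
    (fun p : Fin 3 × Idx => (![-x, ξ, (D.rho i)⁻¹ • c] : Fin 3 → Idx → ℝ) p.1 p.2)
  rw [localLMI, star_trivial, dotProduct_comp_mulVec] at key
  simp only [Fin.sum_univ_three, of_apply, cons_val_zero, cons_val_one, cons_val, neg_mulVec,
    add_mulVec, smul_mulVec, one_mulVec, zero_mulVec, mulVec_neg, mulVec_smul, dotProduct_neg,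
    neg_dotProduct, dotProduct_add, dotProduct_smul, smul_dotProduct, dotProduct_zero, hPξ, hξP,
    hS, smul_eq_mul] at key
  rw [hRx, smul_dotProduct, dotProduct_add, nu, smul_eq_mul]
  rw [dotProduct_comm c ξ, dotProduct_comm c x] at key
  rw [← dotProduct_add, ← add_mulVec] at key
  have h2 := mul_nonneg hρ.le key
  field_simp at h2 ⊢
  nlinarith

theorem transpose_W (D : Design) (i j : ℕ) : (D.W i j)ᵀ = D.W j i := by
  refine transpose_comp_eq fun p q => ?_
  by_cases h : i = j
  · subst h
    fin_cases p <;> fin_cases q <;> simp [Vp, Rp, S, sub_eq_add_neg, add_comm]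
    all_goals exact smul_comm _ _ _
  · have h' : ¬ j = i := fun h' => h h'.symm
    fin_cases p <;> fin_cases q <;> simp [Vp, Rp, S, sub_eq_add_neg, add_comm, h, h']

/-- The part of the quadratic form of `W_ij` that comes from `Q_ij`. -/
def crossTerm (D : Design) (x u : ℕ → Idx → ℝ) (i j : ℕ) : ℝ :=
  -(u i ⬝ᵥ (D.Q i j *ᵥ x j)) + 1 / (2 * D.nu i) * (x i ⬝ᵥ (D.Q i j *ᵥ x j))

/-- The second entry `-x` again eliminates an identity block and produces the output term `-|x|²`.
The `Q`-terms are kept apart because the interconnection law applies to them only after summation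
over a whole row. -/
theorem dotProduct_W_mulVec (D : Design) (x d u : ℕ → Idx → ℝ) (i j : ℕ)
    (hν : D.nu i ≠ 0) :
    (fun p : Fin 4 × Idx => (![-u i, -x i, x i, d i] : Fin 4 → Idx → ℝ) p.1 p.2) ⬝ᵥ
      (D.W i j *ᵥ fun p : Fin 4 × Idx =>
        (![-u j, -x j, x j, d j] : Fin 4 → Idx → ℝ) p.1 p.2) =
    crossTerm D x u i j + crossTerm D x u j i +
      if i = j then -(D.p i * D.nu i) * (u i ⬝ᵥ u i) + 2 * (D.p i * D.nu i) * (u i ⬝ᵥ d i) -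
        x i ⬝ᵥ x i + D.p i * D.rho i * (x i ⬝ᵥ x i) - D.p i * (x i ⬝ᵥ d i) +
        D.gamHat i * (d i ⬝ᵥ d i) else 0 := by
  rw [W, dotProduct_comp_mulVec]
  by_cases h : i = j
  · subst h
    simp only [Fin.sum_univ_four, of_apply, cons_val_zero, cons_val_one, cons_val, neg_mulVec,
      smul_mulVec, one_mulVec, zero_mulVec, mulVec_neg, dotProduct_neg,
      neg_dotProduct, dotProduct_smul, dotProduct_zero,
      sub_mulVec, dotProduct_sub, Vp, Rp, S, if_true, one_smul, Matrix.mul_smul, Matrix.smul_mul,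
      Matrix.mul_one, Matrix.one_mul, dotProduct_transpose_mulVec, smul_eq_mul, crossTerm]
    rw [dotProduct_comm (d i) (u i), dotProduct_comm (d i) (x i),
      dotProduct_comm (D.Q i i *ᵥ x i) (u i), dotProduct_comm (D.Q i i *ᵥ x i) (x i)]
    field_simp
    ring
  · simp only [Fin.sum_univ_four, of_apply, cons_val_zero, cons_val_one, cons_val, neg_mulVec,
      smul_mulVec, zero_mulVec, mulVec_neg, dotProduct_neg,
      neg_dotProduct, dotProduct_smul, dotProduct_zero,
      sub_mulVec, dotProduct_sub, Vp, Rp, S, if_neg h, zero_smul, Matrix.mul_smul, Matrix.smul_mul,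
      Matrix.mul_one, Matrix.one_mul, dotProduct_transpose_mulVec, smul_eq_mul, crossTerm, mul_zero]
    rw [dotProduct_comm (D.Q j i *ᵥ x i) (u j), dotProduct_comm (D.Q j i *ᵥ x i) (x j)]
    ring

/-- The global LMI: the interconnection turns the supply rates of the agents into the
`L₂`-gain supply rate of the network. -/
theorem sum_supply_le {N : ℕ} (hν : ∀ i < N, D.nu i < 0) (hp : ∀ i < N, 0 < D.p i)
    (hT : ∀ i < N, (tilde D.W i i).PosDef) (x d u : ℕ → Idx → ℝ)
    (hu : ∀ i < N, u i = ∑ j ∈ Finset.range N, D.K i j *ᵥ x j + d i) :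
    ∑ i ∈ Finset.range N, D.p i * (x i ⬝ᵥ u i - D.rho i * (x i ⬝ᵥ x i) - D.nu i * (u i ⬝ᵥ u i)) ≤
      ∑ i ∈ Finset.range N, (D.gamHat i * (d i ⬝ᵥ d i) - x i ⬝ᵥ x i) := by
  have h := sum_dotProduct_block_nonneg D.transpose_W hT
    (fun i (p : Fin 4 × Idx) => (![-u i, -x i, x i, d i] : Fin 4 → Idx → ℝ) p.1 p.2)
  rw [Finset.sum_congr rfl fun i hi => Finset.sum_congr rfl fun j _ =>
    dotProduct_W_mulVec D x d u i j (hν i (Finset.mem_range.1 hi)).ne] at h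
  simp only [Finset.sum_add_distrib] at h
  rw [Finset.sum_comm (f := fun i j => crossTerm D x u j i), ← Finset.sum_add_distrib,
    ← Finset.sum_add_distrib] at h
  rw [← sub_nonneg, ← Finset.sum_sub_distrib]
  refine h.trans_eq (Finset.sum_congr rfl fun i hi => ?_)
  have hi' := Finset.mem_range.1 hi
  -- Since `V_p K = Q`, the interconnection law evaluates the row sum of the `Q`-terms through `u -
  -- d`. The cross terms occur twice, once from each triangle of `W`, and complete the supply rate.
  have hQ : ∑ j ∈ Finset.range N, D.Q i j *ᵥ x j = (-(D.p i * D.nu i)) • (u i - d i) := by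
    have hV : -(D.p i * D.nu i) ≠ 0 := by
      have := mul_neg_of_pos_of_neg (hp i hi') (hν i hi'); linarith
    rw [hu i hi', add_sub_cancel_right, Finset.smul_sum]
    refine Finset.sum_congr rfl fun j _ => ?_
    have : D.Vp i * D.K i j = D.Q i j := by
      rw [K, ← Matrix.mul_assoc, mul_nonsing_inv, Matrix.one_mul]
      rw [Vp, det_smul, det_one, mul_one]
      exact (pow_ne_zero _ hV).isUnit
    rw [← this, Vp, Matrix.smul_mul, Matrix.one_mul, smul_mulVec]
  have hc : ∑ j ∈ Finset.range N, crossTerm D x u i j =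
      -(u i ⬝ᵥ ((-(D.p i * D.nu i)) • (u i - d i))) +
        1 / (2 * D.nu i) * (x i ⬝ᵥ ((-(D.p i * D.nu i)) • (u i - d i))) := by
    simp only [← hQ, crossTerm, dotProduct_sum, Finset.sum_add_distrib, Finset.mul_sum,
      Finset.sum_neg_distrib]
  rw [hc, Finset.sum_ite_eq, if_pos hi]
  simp only [dotProduct_smul, dotProduct_sub, smul_eq_mul]
  have := (hν i hi').ne
  field_simp
  ring

/-- `γ̂ᵢ` is a diagonal entry of the positive definite block `W_ii`. This makes `√γ̂ᵢ` usable as a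
gain. -/
theorem gamHat_pos (h : ∀ k ≤ i, (tilde D.W k k).PosDef) : 0 < D.gamHat i := by
  have h1 := (posDef_diag_of_tilde h).diag_pos (i := ((3 : Fin 4), (Sum.inl 0 : Idx)))
  have h2 : D.W i i ((3 : Fin 4), (Sum.inl 0 : Idx)) ((3 : Fin 4), (Sum.inl 0 : Idx)) =
      ((D.gamHat i * if i = i then 1 else 0) • (1 : Matrix Idx Idx ℝ)) (Sum.inl 0) (Sum.inl 0) :=
    rfl
  rw [h2, if_pos rfl] at h1
  simpa only [mul_one, Matrix.smul_apply, one_apply_eq, smul_eq_mul] using h1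

end Design

end Dissipation

/-! ### Quadratic forms and extreme eigenvalues -/

section QuadraticForms

open Matrix

/-- A matrix as an operator on the Euclidean space. -/
abbrev euclOp (M : Matrix Idx Idx ℝ) : EuclideanSpace ℝ Idx →L[ℝ] EuclideanSpace ℝ Idx :=
  Matrix.toEuclideanCLM (n := Idx) (𝕜 := ℝ) M

theorem norm_sq_eq_dotProduct (x : EuclideanSpace ℝ Idx) : ‖x‖ ^ 2 = x.ofLp ⬝ᵥ x.ofLp := by
  rw [← real_inner_self_eq_norm_sq, EuclideanSpace.inner_eq_star_dotProduct, star_trivial]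

theorem inner_eq_dotProduct (x y : EuclideanSpace ℝ Idx) : inner ℝ x y = x.ofLp ⬝ᵥ y.ofLp := by
  rw [EuclideanSpace.inner_eq_star_dotProduct, star_trivial, dotProduct_comm]

theorem inner_euclOp_self_nonneg {M : Matrix Idx Idx ℝ} (hM : M.PosSemidef)
    (x : EuclideanSpace ℝ Idx) : 0 ≤ inner ℝ x (euclOp M x) := by
  rw [inner_toEuclideanCLM]
  simpa using hM.dotProduct_mulVec_nonneg x.ofLp

theorem inner_euclOp_comm {M : Matrix Idx Idx ℝ} (hM : M.IsHermitian)
    (x y : EuclideanSpace ℝ Idx) : inner ℝ (euclOp M x) y = inner ℝ x (euclOp M y) := by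
  have hMt : Mᵀ = M := by simpa using hM.eq
  rw [inner_toEuclideanCLM, inner_eq_dotProduct, ofLp_toEuclideanCLM,
    ← dotProduct_transpose_mulVec, hMt]

theorem finite_spectrum (M : Matrix Idx Idx ℝ) (hM : M.IsHermitian) : (spectrum ℝ M).Finite := by
  rw [hM.spectrum_real_eq_range_eigenvalues]
  exact Set.finite_range _

theorem spectrum_nonempty {M : Matrix Idx Idx ℝ} (hM : M.IsHermitian) :
    (spectrum ℝ M).Nonempty := by
  rw [hM.spectrum_real_eq_range_eigenvalues]
  exact Set.range_nonempty _

theorem lamMin_mul_norm_sq_le {M : Matrix Idx Idx ℝ} (hM : M.IsHermitian)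
    (x : EuclideanSpace ℝ Idx) : lamMin M * ‖x‖ ^ 2 ≤ inner ℝ x (euclOp M x) := by
  have h : (M - algebraMap ℝ _ (lamMin M)).PosSemidef := by
    refine posSemidef_iff_isHermitian_and_spectrum_nonneg.2 ⟨?_, ?_⟩
    · rw [algebraMap_eq_diagonal]
      exact hM.sub (isHermitian_diagonal _)
    · rw [← spectrum.sub_singleton_eq]
      rintro _ ⟨a, ha, b, rfl, rfl⟩
      exact sub_nonneg.2 (csInf_le (finite_spectrum M hM).bddBelow ha)
  have := inner_euclOp_self_nonneg h x
  rw [inner_toEuclideanCLM, sub_mulVec, dotProduct_sub, Algebra.algebraMap_eq_smul_one,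
    smul_mulVec, one_mulVec, dotProduct_smul, ← norm_sq_eq_dotProduct, smul_eq_mul,
    ← inner_toEuclideanCLM] at this
  linarith

theorem inner_euclOp_le_lamMax {M : Matrix Idx Idx ℝ} (hM : M.IsHermitian)
    (x : EuclideanSpace ℝ Idx) : inner ℝ x (euclOp M x) ≤ lamMax M * ‖x‖ ^ 2 := by
  have h : (algebraMap ℝ _ (lamMax M) - M).PosSemidef := by
    refine posSemidef_iff_isHermitian_and_spectrum_nonneg.2 ⟨?_, ?_⟩
    · rw [algebraMap_eq_diagonal]
      exact (isHermitian_diagonal _).sub hM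
    · rw [← spectrum.singleton_sub_eq]
      rintro _ ⟨a, rfl, b, hb, rfl⟩
      exact sub_nonneg.2 (le_csSup (finite_spectrum M hM).bddAbove hb)
  have := inner_euclOp_self_nonneg h x
  rw [inner_toEuclideanCLM, sub_mulVec, dotProduct_sub, Algebra.algebraMap_eq_smul_one,
    smul_mulVec, one_mulVec, dotProduct_smul, ← norm_sq_eq_dotProduct, smul_eq_mul,
    ← inner_toEuclideanCLM] at this
  linarith

theorem lamMin_pos {M : Matrix Idx Idx ℝ} (hM : M.PosDef) : 0 < lamMin M := by
  have h := (spectrum_nonempty hM.isHermitian).csInf_mem (finite_spectrum M hM.isHermitian)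
  rw [hM.isHermitian.spectrum_real_eq_range_eigenvalues] at h
  obtain ⟨i, hi⟩ := h
  rw [lamMin, hM.isHermitian.spectrum_real_eq_range_eigenvalues, ← hi]
  exact hM.eigenvalues_pos i

theorem lamMin_le_lamMax {M : Matrix Idx Idx ℝ} (hM : M.IsHermitian) : lamMin M ≤ lamMax M :=
  csInf_le_csSup (spectrum_nonempty hM) (finite_spectrum M hM).bddBelow
    (finite_spectrum M hM).bddAbove

/-- Young's inequality in the seminorm of `M`: expand the form at `s x - y` and divide by `s`. -/
theorem two_mul_inner_euclOp_le {M : Matrix Idx Idx ℝ} (hM : M.PosSemidef) {s : ℝ} (hs : 0 < s)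
    (x y : EuclideanSpace ℝ Idx) :
    2 * inner ℝ x (euclOp M y) ≤ s * inner ℝ x (euclOp M x) + s⁻¹ * inner ℝ y (euclOp M y) := by
  have h := inner_euclOp_self_nonneg hM (s • x - y)
  have h2 : inner ℝ y (euclOp M x) = inner ℝ x (euclOp M y) := by
    rw [← inner_euclOp_comm hM.isHermitian, real_inner_comm]
  simp only [map_sub, map_smul, inner_sub_left, inner_sub_right, real_inner_smul_left,
    real_inner_smul_right, h2] at h
  have h3 := mul_nonneg (inv_pos.2 hs).le h
  have h4 : s⁻¹ * (s * (s * inner ℝ x (euclOp M x)) - s * inner ℝ x (euclOp M y) -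
      (s * inner ℝ x (euclOp M y) - inner ℝ y (euclOp M y))) =
      s * inner ℝ x (euclOp M x) - 2 * inner ℝ x (euclOp M y) +
        s⁻¹ * inner ℝ y (euclOp M y) := by
    field_simp; ring
  linarith

end QuadraticForms

/-! ### The closed loop as a linear system -/

namespace Design

variable {D : Design} {N : ℕ} {gbar : ℝ}

theorem K0_eq (D : Design) {N i : ℕ} (hi : i < N) :
    D.K0 N i = D.K i i + ∑ j ∈ (Finset.range N).erase i, D.K i j := by
  induction N with
  | zero => omega
  | succ n ih =>
    rcases Nat.lt_succ_iff_lt_or_eq.1 hi with h | rfl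
    · have h1 : (Finset.range (n + 1)).erase i = insert n ((Finset.range n).erase i) := by
        ext k; simp only [Finset.mem_erase, Finset.mem_range, Finset.mem_insert]; omega
      rw [K0, if_pos h, ih h, h1, Finset.sum_insert (by simp)]
      abel
    · have h1 : (Finset.range (i + 1)).erase i = Finset.range i := by
        ext k; simp only [Finset.mem_erase, Finset.mem_range]; omega
      rw [K0, if_neg (lt_irrefl _), if_pos rfl, h1]

/-- The control input of agent `i` and its disturbance. -/
def agentInput (D : Design) {N : ℕ} (x w : Stack N) (i : Fin N) : EuclideanSpace ℝ Idx :=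
  ∑ j : Fin N, euclOp (D.K i j) (x j) + w i

/-- After all joins `K_{i0}` is the full row sum of the gains, so it absorbs every `-K_ij xᵢ` and
contributes `K_ii xᵢ`. What remains is the input `∑ⱼ K_ij xⱼ + wᵢ` used in the global LMI. -/
theorem closedLoop_apply (D : Design) {N : ℕ} (x w : Stack N) (i : Fin N) :
    D.closedLoop N x w i =
      euclOp (matA + matB * D.Lbar i) (x i) + agentInput D x w i := by
  have h0 : D.K0 N i = D.K i i + ∑ j ∈ Finset.univ.erase i, D.K i j := by
    rw [K0_eq D i.2]
    congr 1
    refine add_left_cancel (a := D.K i i) ?_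
    rw [Finset.add_sum_erase _ _ (Finset.mem_range.2 i.2),
      Finset.add_sum_erase _ (fun j : Fin N => D.K i j) (Finset.mem_univ i),
      Fin.sum_univ_eq_sum_range (fun j => D.K i j)]
  change euclOp (matA + matB * D.Lbar i) (x i) + euclOp (D.K0 N i) (x i) +
    ∑ j ∈ Finset.univ.erase i, euclOp (D.K i j) (x j - x i) + w i = _
  have h1 : euclOp (D.K0 N i) (x i) = euclOp (D.K i i) (x i) +
      ∑ j ∈ Finset.univ.erase i, euclOp (D.K i j) (x i) := by
    simp only [h0, euclOp, map_add, map_sum, sum_apply, add_apply]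
  rw [h1, agentInput]
  simp only [map_sub, Finset.sum_sub_distrib]
  rw [← Finset.add_sum_erase _ (fun j : Fin N => euclOp (D.K i j) (x j)) (Finset.mem_univ i)]
  abel

theorem closedLoop_add (D : Design) (N : ℕ) (x y v w : Stack N) :
    D.closedLoop N (x + y) (v + w) = D.closedLoop N x v + D.closedLoop N y w := by
  refine PiLp.ext fun i => ?_
  rw [PiLp.add_apply, closedLoop_apply, closedLoop_apply, closedLoop_apply]
  simp only [PiLp.add_apply, agentInput, map_add, Finset.sum_add_distrib]
  abel

theorem closedLoop_smul (D : Design) (N : ℕ) (c : ℝ) (x w : Stack N) :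
    D.closedLoop N (c • x) (c • w) = c • D.closedLoop N x w := by
  refine PiLp.ext fun i => ?_
  rw [PiLp.smul_apply, closedLoop_apply, closedLoop_apply]
  simp only [PiLp.smul_apply, agentInput, map_smul, smul_add, Finset.smul_sum]

theorem closedLoop_zero_left (D : Design) (N : ℕ) (w : Stack N) : D.closedLoop N 0 w = w := by
  refine PiLp.ext fun i => ?_
  simp [closedLoop_apply, agentInput]

/-- The bilinear form `x_iᵀ R_i y_i`. -/
def energy (D : Design) {N : ℕ} (i : Fin N) : Stack N →L[ℝ] Stack N →L[ℝ] ℝ :=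
  (innerSL ℝ : EuclideanSpace ℝ Idx →L[ℝ] EuclideanSpace ℝ Idx →L[ℝ] ℝ).bilinearComp
    (PiLp.proj 2 _ i) (euclOp (D.R i) ∘L PiLp.proj 2 _ i)

theorem energy_apply (D : Design) {N : ℕ} (i : Fin N) (x y : Stack N) :
    energy D i x y = inner ℝ (x i) (euclOp (D.R i) (y i)) := rfl

theorem energy_add_energy {i : Fin N} (hR : (D.R i).IsHermitian) (x y : Stack N) :
    energy D i x y + energy D i y x = 2 * inner ℝ (euclOp (D.R i) (x i)) (y i) := by
  rw [energy_apply, energy_apply, ← inner_euclOp_comm hR, real_inner_comm]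
  ring

end Design

/-! ### Consequences of dissipation along trajectories -/

section Trajectories

variable {E U : Type*} [NormedAddCommGroup E] [NormedSpace ℝ E]

theorem IsSolution.eq_primitive {f : E → U → E} {u : ℝ → U} {x₀ : E} {x : ℝ → E}
    (hx : IsSolution f u x₀ x) {t : ℝ} (ht : 0 ≤ t) :
    x t = primitive x₀ (fun s => f (x s) (u s)) t := (hx.2 t ht).2

/-- Decay of the maximum of finitely many quadratic forms along a trajectory. -/
theorem quadratic_le_of_max_dissipation [FiniteDimensional ℝ E] {f : E → U → E} {u : ℝ → U}
    {x₀ : E} {x : ℝ → E} (hx : IsSolution f u x₀ x) {ι : Type*} [Fintype ι]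
    (B : ι → E →L[ℝ] E →L[ℝ] ℝ) {P : U → Prop} (hP : ∀ t, 0 ≤ t → P (u t))
    {a b : ι → ℝ} {α κ c : ℝ} (hα : 0 < α) (hκ : 0 ≤ κ) (hc : 0 ≤ c)
    (hab : ∀ i, a i + α ≤ b i)
    (hB : ∀ y v, P v → ∀ i m, (∀ j, B j y y ≤ m) →
      B i y (f y v) + B i (f y v) y ≤ -b i * B i y y + a i * m + κ)
    (h0 : ∀ i, B i x₀ x₀ ≤ c) {t : ℝ} (ht : 0 ≤ t) (i : ι) :
    B i (x t) (x t) ≤ c * Real.exp (-(α * t)) + κ / α := by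
  have : CompleteSpace E := FiniteDimensional.complete ℝ E
  set g : ℝ → E := fun s => f (x s) (u s)
  have hg : ∀ T, 0 ≤ T → IntervalIntegrable g volume 0 T := fun T hT => (hx.2 T hT).1
  have hp : ∀ t, 0 ≤ t → primitive x₀ g t = x t := fun t ht => (hx.eq_primitive ht).symm
  refine le_of_forall_pos_le_add fun ε hε => ?_
  -- The comparison principle needs a strict initial inequality, hence `c + ε`.
  have key := lt_exp_of_deriv_le_max (φ := fun i t => B i (primitive x₀ g t) (primitive x₀ g t))
    (a := a) (b := b) (c := c + ε) hα hκ (by positivity) hab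
    (fun i T hT => absolutelyContinuous_quadratic x₀ (hg T hT) (B i))
    (fun i T hT => by
      filter_upwards [ae_hasDerivAt_quadratic x₀ hT (hg T hT) (B i)] with s hs hsT
      refine ⟨(hs hsT).differentiableAt, fun m hm => ?_⟩
      rw [(hs hsT).deriv]
      rw [hp s hsT.1]
      simp only [hp s hsT.1] at hm
      exact hB _ _ (hP s hsT.1) i m hm)
    (fun i => by
      have : primitive x₀ g 0 = x₀ := by simp [primitive]
      simp only [this]
      linarith [h0 i]) ht i
  rw [hx.eq_primitive ht]
  have h1 : ε * Real.exp (-(α * t)) ≤ ε :=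
    mul_le_of_le_one_right hε.le (Real.exp_le_one_iff.2 (by nlinarith))
  rw [add_mul] at key
  linarith

/-- The dissipation inequality in integrated form. -/
theorem quadratic_sub_le_integral [FiniteDimensional ℝ E] {f : E → U → E} {u : ℝ → U}
    {x₀ : E} {x : ℝ → E} (hx : IsSolution f u x₀ x) (B : E →L[ℝ] E →L[ℝ] ℝ) {s : ℝ → ℝ} {T : ℝ}
    (hT : 0 ≤ T) (hs : IntervalIntegrable s volume 0 T)
    (hB : ∀ t, 0 ≤ t → B (x t) (f (x t) (u t)) + B (f (x t) (u t)) (x t) ≤ s t) :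
    B (x T) (x T) - B x₀ x₀ ≤ ∫ t in (0 : ℝ)..T, s t := by
  have : CompleteSpace E := FiniteDimensional.complete ℝ E
  set g : ℝ → E := fun s => f (x s) (u s)
  have hg : IntervalIntegrable g volume 0 T := (hx.2 T hT).1
  have hp : ∀ t, 0 ≤ t → primitive x₀ g t = x t := fun t ht => (hx.eq_primitive ht).symm
  have hAC := absolutelyContinuous_quadratic x₀ hg B
  have h0 : primitive x₀ g 0 = x₀ := by simp [primitive]
  have h1 := hAC.integral_deriv_eq_sub
  simp only [h0, hp T hT] at h1
  rw [← h1]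
  refine intervalIntegral.integral_mono_ae_restrict hT hAC.intervalIntegrable_deriv hs ?_
  rw [Filter.EventuallyLE, ae_restrict_iff' measurableSet_Icc]
  filter_upwards [ae_hasDerivAt_quadratic x₀ hT hg B] with t ht htT
  rw [(ht htT).deriv, hp t htT.1]
  exact hB t htT.1

/-- By additivity the deviation from any equilibrium obeys the same dynamics, so `B (x - x*, x -
x*)` inherits the dissipation inequality at the origin. -/
theorem isL2G_of_quadratic {f : E → E → E} {γ : ℝ} (B : E →L[ℝ] E →L[ℝ] ℝ)
    (hadd : ∀ x y v w, f (x + y) (v + w) = f x v + f y w)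
    (hpos : ∀ y, y ≠ 0 → 0 < B y y)
    (hB : ∀ y v, B y (f y v) + B (f y v) y ≤ γ ^ 2 * ‖v‖ ^ 2 - ‖y‖ ^ 2) :
    IsL2G f (fun x _ => x) γ := by
  refine ⟨fun p => B (p.1 - p.2) (p.1 - p.2), by fun_prop, fun xs us hf => ⟨by simp, fun x hx =>
    hpos _ (sub_ne_zero.2 hx), fun x u => ?_⟩⟩
  have h1 : HasFDerivAt (fun y : E => y - xs) (ContinuousLinearMap.id ℝ E) x :=
    (hasFDerivAt_id x).sub_const xs
  have h2 := B.hasFDerivAt_of_bilinear h1 h1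
  rw [h2.fderiv]
  have h3 : f x u = f (x - xs) (u - us) := by
    have := hadd (x - xs) xs (u - us) us
    rwa [sub_add_cancel, sub_add_cancel, hf, add_zero] at this
  have := hB (x - xs) (u - us)
  rw [← h3] at this
  simpa using this

theorem hasL2Gain_of_quadratic [NormedAddCommGroup U] [FiniteDimensional ℝ E]
    {f : E → U → E} {γ : ℝ} (hγ : 0 ≤ γ)
    (B : E →L[ℝ] E →L[ℝ] ℝ) (hpos : ∀ y, 0 ≤ B y y)
    (hB : ∀ y v, B y (f y v) + B (f y v) y ≤ γ ^ 2 * ‖v‖ ^ 2 - ‖y‖ ^ 2) :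
    HasL2Gain f (fun x _ => x) γ := by
  refine ⟨fun x₀ => Real.sqrt (B x₀ x₀), by simp, fun x₀ u x hu hx => ?_⟩
  have hui : IntegrableOn (fun t => ‖u t‖ ^ 2) (Set.Ici 0) := by
    have := hu.integrable_norm_pow (by norm_num)
    simpa [IntegrableOn] using this
  set G : ℝ := ∫ t in Set.Ici (0 : ℝ), ‖u t‖ ^ 2 with hG
  have hG0 : 0 ≤ G := integral_nonneg fun t => by positivity
  have hunorm : eLpNorm u 2 (volume.restrict (Set.Ici 0)) = ENNReal.ofReal (Real.sqrt G) := by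
    rw [hu.eLpNorm_eq_integral_rpow_norm (by norm_num) (by norm_num), Real.sqrt_eq_rpow, hG]
    norm_num
  have hT : ∀ T : ℝ, 0 ≤ T → ∫ t in (0 : ℝ)..T, ‖x t‖ ^ 2 ≤ B x₀ x₀ + γ ^ 2 * G := by
    intro T hT
    have hu1 : IntervalIntegrable (fun t => γ ^ 2 * ‖u t‖ ^ 2) volume 0 T := by
      refine IntervalIntegrable.const_mul ?_ _
      exact (hui.mono_set fun t ht => by
        rw [Set.uIcc_of_le hT] at ht; exact ht.1).intervalIntegrable
    have hx1 : IntervalIntegrable (fun t => ‖x t‖ ^ 2) volume 0 T := by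
      refine ContinuousOn.intervalIntegrable ?_
      refine (hx.1.mono fun t ht => ?_).norm.pow 2
      rw [Set.uIcc_of_le hT] at ht; exact ht.1
    have h1 := quadratic_sub_le_integral hx B hT (hu1.sub hx1) fun t _ => hB _ _
    rw [intervalIntegral.integral_sub hu1 hx1, intervalIntegral.integral_const_mul] at h1
    have h2 : ∫ t in (0 : ℝ)..T, ‖u t‖ ^ 2 ≤ G := by
      rw [intervalIntegral.integral_of_le hT]
      exact setIntegral_mono_set hui (Filter.Eventually.of_forall fun t => by positivity)
        (Filter.Eventually.of_forall fun t (ht : t ∈ Set.Ioc 0 T) => ht.1.le)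
    nlinarith [hpos (x T), mul_le_mul_of_nonneg_left h2 (sq_nonneg γ)]
  -- Square integrability of `x` on the half-line is not known in advance, so the bounds on `[0, n]`
  -- pass to the limit as lower Lebesgue integrals.
  have hlin : ∫⁻ t in Set.Ici (0 : ℝ), ‖x t‖ₑ ^ (2 : ℝ) ≤
      ENNReal.ofReal (B x₀ x₀ + γ ^ 2 * G) := by
    have hU : Set.Ici (0 : ℝ) = ⋃ n : ℕ, Set.Icc 0 (n : ℝ) := by
      ext t
      simp only [Set.mem_Ici, Set.mem_iUnion, Set.mem_Icc]
      exact ⟨fun h => (exists_nat_ge t).imp fun n hn => ⟨h, hn⟩, fun ⟨_, h⟩ => h.1⟩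
    rw [hU, setLIntegral_iUnion_of_directed]
    · refine iSup_le fun n => ?_
      have hn : (0 : ℝ) ≤ n := n.cast_nonneg
      have hxi : IntegrableOn (fun t => ‖x t‖ ^ 2) (Set.Icc 0 (n : ℝ)) :=
        ((hx.1.mono fun t ht => ht.1).norm.pow 2).integrableOn_Icc
      have h1 := hT n hn
      rw [intervalIntegral.integral_of_le hn, ← integral_Icc_eq_integral_Ioc] at h1
      refine le_trans (le_of_eq ?_) (ENNReal.ofReal_le_ofReal h1)
      rw [ofReal_integral_eq_lintegral_ofReal hxi
        (Filter.Eventually.of_forall fun t => by positivity)]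
      refine lintegral_congr fun t => ?_
      rw [← ofReal_norm, ENNReal.ofReal_rpow_of_nonneg (norm_nonneg _) (by norm_num)]
      norm_num
    · refine directed_of_isDirected_le fun m n hmn => ?_
      exact Set.Icc_subset_Icc_right (by exact_mod_cast hmn)
  have hB0 := hpos x₀
  calc eLpNorm (fun t => x t) 2 (volume.restrict (Set.Ici 0))
      = (∫⁻ t in Set.Ici (0 : ℝ), ‖x t‖ₑ ^ (2 : ℝ)) ^ ((1 : ℝ) / 2) := by
        rw [eLpNorm_eq_lintegral_rpow_enorm_toReal (by norm_num) (by norm_num)]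
        norm_num
    _ ≤ (ENNReal.ofReal (B x₀ x₀ + γ ^ 2 * G)) ^ ((1 : ℝ) / 2) := by gcongr
    _ = ENNReal.ofReal (Real.sqrt (B x₀ x₀ + γ ^ 2 * G)) := by
        rw [ENNReal.ofReal_rpow_of_nonneg (by positivity) (by norm_num), Real.sqrt_eq_rpow]
    _ ≤ ENNReal.ofReal (γ * Real.sqrt G + Real.sqrt (B x₀ x₀)) := by
        refine ENNReal.ofReal_le_ofReal (Real.sqrt_le_iff.2 ⟨by positivity, ?_⟩)
        nlinarith [Real.sq_sqrt hG0, Real.sq_sqrt hB0,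
          mul_nonneg (mul_nonneg hγ (Real.sqrt_nonneg G)) (Real.sqrt_nonneg (B x₀ x₀))]
    _ = ENNReal.ofReal γ * eLpNorm u 2 (volume.restrict (Set.Ici 0)) +
          ENNReal.ofReal (Real.sqrt (B x₀ x₀)) := by
        rw [hunorm, ENNReal.ofReal_add (by positivity) (by positivity), ENNReal.ofReal_mul hγ]

end Trajectories

/-! ### Scalable mesh stability from exponential bounds -/

section MeshStability

theorem isClassKL_exp {C α : ℝ} (hC : 0 < C) (hα : 0 < α) :
    IsClassKL fun r t => C * r * Real.exp (-(α * t)) := by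
  refine ⟨fun t _ => ⟨by fun_prop, fun r _ s _ hrs => ?_, by simp⟩, fun r hr => ⟨?_, ?_⟩⟩
  · have := Real.exp_pos (-(α * t))
    simp only
    gcongr
  · intro s _ t _ hst
    simp only
    gcongr
  · have h1 : Filter.Tendsto (fun t => Real.exp (-(α * t))) Filter.atTop (𝓝 0) :=
      Real.tendsto_exp_neg_atTop_nhds_zero.comp (Filter.tendsto_id.const_mul_atTop hα)
    simpa using h1.const_mul (C * r)

theorem isClassKInf_mul {G : ℝ} (hG : 0 < G) : IsClassKInf fun r => G * r :=
  ⟨⟨by fun_prop, fun r _ s _ hrs => by simp only; gcongr, by simp⟩,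
    Filter.tendsto_id.const_mul_atTop hG⟩

theorem intervalIntegrable_stack {N : ℕ} {w : ℝ → Stack N}
    (hw : AEStronglyMeasurable w (volume.restrict (Set.Ici 0)))
    (hb : ∀ i, BddAbove (Set.range fun t : Set.Ici (0 : ℝ) => ‖w t i‖)) {t : ℝ} (ht : 0 ≤ t) :
    IntervalIntegrable w volume 0 t := by
  choose M hM using hb
  have hM' : ∀ s, 0 ≤ s → ‖w s‖ ≤ Real.sqrt (∑ i, M i ^ 2) := by
    intro s hs
    refine Real.le_sqrt_of_sq_le ?_
    rw [PiLp.norm_sq_eq_of_L2]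
    refine Finset.sum_le_sum fun i _ => ?_
    have := hM i ⟨⟨s, hs⟩, rfl⟩
    gcongr
  rw [intervalIntegrable_iff_integrableOn_Ioc_of_le ht]
  refine Integrable.of_bound (hw.mono_measure (Measure.restrict_mono
    (fun s (hs : s ∈ Set.Ioc 0 t) => hs.1.le) le_rfl)) (Real.sqrt (∑ i, M i ^ 2)) ?_
  exact (ae_restrict_iff' measurableSet_Ioc).2
    (Filter.Eventually.of_forall fun s hs => hM' s hs.1.le)

theorem isScalableMeshStable_of_exp_bound {𝒩 : Set Network} {C G α : ℝ} (hC : 0 < C) (hG : 0 < G)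
    (hα : 0 < α)
    (hex : ∀ net ∈ 𝒩, ∀ (w : ℝ → Stack net.1) (x₀ : Stack net.1),
      (∀ t, 0 ≤ t → IntervalIntegrable w volume 0 t) → ∃ x, IsSolution net.2 w x₀ x)
    (hb : ∀ net ∈ 𝒩, ∀ (w : ℝ → Stack net.1) (x₀ : Stack net.1) (x : ℝ → Stack net.1),
      IsSolution net.2 w x₀ x → ∀ X W : ℝ, 0 ≤ X → 0 ≤ W → (∀ i, ‖x₀ i‖ ≤ X) →
      (∀ t, 0 ≤ t → ∀ i, ‖w t i‖ ≤ W) → ∀ t, 0 ≤ t → ∀ i,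
      ‖x t i‖ ≤ C * X * Real.exp (-(α * t)) + G * W) :
    IsScalableMeshStable 𝒩 := by
  -- The assumed bound is global, so the radii `c_x`, `c_w` are arbitrary.
  refine ⟨_, _, 1, 1, isClassKL_exp hC hα, isClassKInf_mul hG, one_pos, one_pos, ?_⟩
  intro net hnet x₀ w hw hbd _ _
  refine ⟨hex net hnet w x₀ fun t ht => intervalIntegrable_stack hw hbd ht, fun x hx t ht => ?_⟩
  have hX : 0 ≤ ⨆ i, ‖x₀ i‖ := Real.iSup_nonneg fun i => norm_nonneg _
  have hW : 0 ≤ ⨆ i, linfNorm fun s => w s i :=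
    Real.iSup_nonneg fun i => Real.iSup_nonneg fun s => norm_nonneg _
  refine Real.iSup_le (fun i => ?_) (by positivity)
  refine hb net hnet w x₀ x hx _ _ hX hW 
    (fun i => le_ciSup (f := fun i => ‖x₀ i‖) (Set.finite_range _).bddAbove i)
    (fun s hs i => ?_) t ht i
  exact (le_ciSup (hbd i) (⟨s, hs⟩ : Set.Ici (0 : ℝ))).trans
    (le_ciSup (f := fun i => linfNorm fun s => w s i) (Set.finite_range _).bddAbove i)

end MeshStability

/-! ### Dyadic sums and the scalar decay estimate -/

section Scalars

theorem le_of_sq_le_exp {n C G X W α t : ℝ} (hC : 0 ≤ C) (hG : 0 ≤ G) (hX : 0 ≤ X)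
    (hW : 0 ≤ W) (h : n ^ 2 ≤ C * X ^ 2 * Real.exp (-(α * t)) + G * W ^ 2) :
    n ≤ Real.sqrt C * X * Real.exp (-(α / 2 * t)) + Real.sqrt G * W := by
  have he : Real.exp (-(α * t)) = Real.exp (-(α / 2 * t)) ^ 2 := by
    rw [← Real.exp_nat_mul]; congr 1; push_cast; ring
  have h1 : 0 ≤ Real.sqrt C * X * Real.exp (-(α / 2 * t)) := by positivity
  have h2 : 0 ≤ Real.sqrt G * W := by positivity
  refine le_of_abs_le (abs_le_of_sq_le_sq ?_ (by positivity))
  have h3 : C * X ^ 2 * Real.exp (-(α * t)) =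
      (Real.sqrt C * X * Real.exp (-(α / 2 * t))) ^ 2 := by
    rw [he, mul_pow, mul_pow, Real.sq_sqrt hC]
  have h4 : G * W ^ 2 = (Real.sqrt G * W) ^ 2 := by rw [mul_pow, Real.sq_sqrt hG]
  rw [h3, h4] at h
  nlinarith [mul_nonneg h1 h2]

theorem sum_range_inv_two_pow (n : ℕ) :
    ∑ j ∈ Finset.range n, (1 : ℝ) / 2 ^ (j + 1) = 1 - 1 / 2 ^ n := by
  induction n with
  | zero => simp
  | succ n ih => rw [Finset.sum_range_succ, ih, pow_succ]; field_simp; ring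

theorem sum_lt_of_dyadic_bound {s : Finset ℕ} {n : ℕ} (hs : s ⊆ Finset.range n) {a : ℕ → ℝ}
    {δ v : ℝ} (hδ : 0 < δ) (hv : 0 < v) (h : ∀ j ∈ s, a j / δ ≤ v / 2 ^ (j + 1)) :
    ∑ j ∈ s, a j < v * δ := by
  calc ∑ j ∈ s, a j ≤ ∑ j ∈ s, v * δ * (1 / 2 ^ (j + 1)) := by
        refine Finset.sum_le_sum fun j hj => ?_
        have := (div_le_iff₀ hδ).1 (h j hj)
        refine this.trans_eq ?_
        ring
    _ ≤ ∑ j ∈ Finset.range n, v * δ * (1 / 2 ^ (j + 1)) :=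
        Finset.sum_le_sum_of_subset_of_nonneg hs fun j _ _ => by positivity
    _ = v * δ * (1 - 1 / 2 ^ n) := by rw [← Finset.mul_sum, sum_range_inv_two_pow]
    _ < v * δ := mul_lt_of_lt_one_right (by positivity) (sub_lt_self _ (by positivity))

/-- Weights for which the dyadic couplings are a contraction of the weighted maximum norm. -/
def weight (j : ℕ) : ℝ := if j = 0 then 2 / 3 else 1

theorem weight_pos (j : ℕ) : 0 < weight j := by
  unfold weight; split_ifs <;> norm_num

theorem weight_le_one (j : ℕ) : weight j ≤ 1 := by
  unfold weight; split_ifs <;> norm_num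

theorem two_thirds_le_weight (j : ℕ) : 2 / 3 ≤ weight j := by
  unfold weight; split_ifs <;> norm_num

/-- The weight `2/3` replaces the leading term `1/2` of the geometric series by `1/3`, which lowers
its limit from `1` to `5/6`. -/
theorem sum_weight_div_le (n : ℕ) :
    ∑ j ∈ Finset.range (n + 1), weight j / 2 ^ (j + 1) = 5 / 6 - 1 / 2 ^ (n + 1) := by
  induction n with
  | zero => norm_num [weight]
  | succ n ih =>
    rw [Finset.sum_range_succ, ih, weight, if_neg (Nat.succ_ne_zero n), pow_succ _ (n + 1)]
    field_simp; ring

/-- Rows `i ≥ 1` have weight `1` and sum below `5/6`. Row `0` lacks its own term `1/3`, so its sum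
is below `1/2`, hence below `5/6 * 2/3 = 5/9`. -/
theorem sum_erase_weight_div_le {n i : ℕ} (hi : i < n) :
    ∑ j ∈ (Finset.range n).erase i, weight j / 2 ^ (j + 1) ≤ 5 / 6 * weight i := by
  obtain ⟨n, rfl⟩ : ∃ m, n = m + 1 := ⟨n - 1, by omega⟩
  have h1 := Finset.add_sum_erase (Finset.range (n + 1)) (fun j => weight j / 2 ^ (j + 1))
    (Finset.mem_range.2 hi)
  rw [sum_weight_div_le] at h1
  have h2 : (0 : ℝ) < 1 / 2 ^ (n + 1) := by positivity
  by_cases h0 : i = 0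
  · subst h0
    have h4 : weight 0 = 2 / 3 := if_pos rfl
    rw [h4] at h1 ⊢
    linarith
  · have h3 : (0 : ℝ) < weight i / 2 ^ (i + 1) := div_pos (weight_pos i) (by positivity)
    have h4 : weight i = 1 := if_neg h0
    rw [h4] at h1 h3 ⊢
    linarith

theorem sum_erase_div_le {N : ℕ} (i : Fin N) {y : Fin N → ℝ} {r : ℝ} (hr : 0 ≤ r)
    (hy : ∀ j : Fin N, y j ≤ weight j * r) :
    ∑ j ∈ Finset.univ.erase i, y j / 2 ^ ((j : ℕ) + 1) ≤ 5 / 6 * weight i * r := by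
  have h1 : ∑ j ∈ Finset.univ.erase i, weight j / 2 ^ ((j : ℕ) + 1) ≤ 5 / 6 * weight i := by
    refine (le_of_eq ?_).trans (sum_erase_weight_div_le i.2)
    refine add_left_cancel (a := weight i / 2 ^ ((i : ℕ) + 1)) ?_
    rw [Finset.add_sum_erase _ (fun j => weight j / 2 ^ (j + 1)) (Finset.mem_range.2 i.2),
      Finset.add_sum_erase _ (fun j : Fin N => weight j / 2 ^ ((j : ℕ) + 1)) (Finset.mem_univ i),
      Fin.sum_univ_eq_sum_range (fun j => weight j / 2 ^ (j + 1))]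
  calc ∑ j ∈ Finset.univ.erase i, y j / 2 ^ ((j : ℕ) + 1)
      ≤ ∑ j ∈ Finset.univ.erase i, weight j / 2 ^ ((j : ℕ) + 1) * r := by
        refine Finset.sum_le_sum fun j _ => ?_
        rw [div_mul_eq_mul_div]
        have := hy j
        gcongr
    _ = (∑ j ∈ Finset.univ.erase i, weight j / 2 ^ ((j : ℕ) + 1)) * r := by rw [Finset.sum_mul]
    _ ≤ 5 / 6 * weight i * r := by gcongr

/-- The decay estimate of the energy of one agent, with rate and gains that do not depend on the
margin `c - 1`. -/
theorem agent_decay {c lmin lmax δ n s m S V dV rw ww W : ℝ} (hc : 1 < c) (hmin : 0 < lmin)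
    (hmax : 0 < lmax) (hδ0 : 0 ≤ δ) (hδ : δ ^ 2 = (c - 1) * lmin / lmax) (hn : 0 ≤ n)
    (hs : 0 < s) (hm : 0 ≤ m) (hS : S ≤ 5 / 6 * s * Real.sqrt m) (hV : V ≤ lmax * n ^ 2)
    (hdV : dV ≤ -c * n ^ 2 + 2 * δ * n * S + 2 * rw)
    (hrw : 2 * rw ≤ c / (18 * lmax) * V + (c / (18 * lmax))⁻¹ * ww)
    (hww : ww ≤ lmax * W ^ 2) :
    (lmin * s ^ 2)⁻¹ * dV ≤ -(8 / 9 * (c / (2 * lmax))) * ((lmin * s ^ 2)⁻¹ * V) +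
      25 / 36 * (c / (2 * lmax)) * m + 18 * lmax ^ 2 * W ^ 2 / (c * (lmin * s ^ 2)) := by
  have hc0 : 0 < c := by linarith
  set q := Real.sqrt m with hq
  have hqm : q ^ 2 = m := Real.sq_sqrt hm
  -- The decay `c n²` is shared out: `c/2` pays for the coupling, `c/18` for the disturbance, and
  -- `4c/9 = 8/9 * c/2` remains, still above the coupling factor `25/36`.
  have h1 : 2 * δ * n * S ≤ c / 2 * n ^ 2 + 2 / c * δ ^ 2 * (25 / 36 * s ^ 2 * m) := by
    have h2 : 2 * δ * n * S ≤ 2 * δ * n * (5 / 6 * s * q) := by gcongr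
    have h3 : 0 ≤ 2 / c * (c / 2 * n - δ * (5 / 6 * s * q)) ^ 2 := by positivity
    have h4 : 2 / c * (c / 2 * n - δ * (5 / 6 * s * q)) ^ 2 =
        c / 2 * n ^ 2 - 2 * δ * n * (5 / 6 * s * q) +
          2 / c * δ ^ 2 * (25 / 36 * s ^ 2 * q ^ 2) := by
      field_simp; ring
    rw [hqm] at h4
    linarith
  have h5 : c / (18 * lmax) * V ≤ c / 18 * n ^ 2 := by
    have : c / (18 * lmax) * V ≤ c / (18 * lmax) * (lmax * n ^ 2) := by gcongr
    refine this.trans_eq ?_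
    field_simp
  have h6 : (c / (18 * lmax))⁻¹ * ww ≤ 18 * lmax ^ 2 * W ^ 2 / c := by
    have : (c / (18 * lmax))⁻¹ * ww ≤ (c / (18 * lmax))⁻¹ * (lmax * W ^ 2) := by gcongr
    refine this.trans_eq ?_
    field_simp
  have h7 : 4 / 9 * (c / lmax) * V ≤ 4 / 9 * c * n ^ 2 := by
    have : 4 / 9 * (c / lmax) * V ≤ 4 / 9 * (c / lmax) * (lmax * n ^ 2) := by gcongr
    refine this.trans_eq ?_
    field_simp
  -- Equivalent to `4 (c - 1) ≤ c²`, that is `(c - 2)² ≥ 0`. Hence no lower bound on `c - 1` is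
  -- needed.
  have h8 : 2 / c * δ ^ 2 ≤ c / (2 * lmax) * lmin := by
    rw [hδ, div_mul_div_comm, div_mul_eq_mul_div, div_le_div_iff₀ (by positivity) (by positivity)]
    have : 0 ≤ lmin * lmax * (c - 2) ^ 2 := by positivity
    nlinarith
  have h9 : 2 / c * δ ^ 2 * (25 / 36 * s ^ 2 * m) ≤
      c / (2 * lmax) * lmin * (25 / 36 * s ^ 2 * m) := by gcongr
  have h10 : dV ≤ -(4 / 9 * (c / lmax)) * V + c / (2 * lmax) * lmin * (25 / 36 * s ^ 2 * m) +
      18 * lmax ^ 2 * W ^ 2 / c := by linarith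
  have h11 : (lmin * s ^ 2)⁻¹ * dV ≤ (lmin * s ^ 2)⁻¹ * (-(4 / 9 * (c / lmax)) * V +
      c / (2 * lmax) * lmin * (25 / 36 * s ^ 2 * m) + 18 * lmax ^ 2 * W ^ 2 / c) := by gcongr
  refine h11.trans_eq ?_
  field_simp
  ring

end Scalars

/-! ### Stability of feasible networks -/

namespace Design

variable {D : Design} {N : ℕ} {gbar : ℝ} {i : ℕ}

namespace IsFeasible

theorem nu_neg (h : D.IsFeasible gbar N) (hi : i < N) : D.nu i < 0 :=
  mul_neg_of_pos_of_neg (inv_pos.2 (h.rho_pos i hi)) (h.nut_neg i hi)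

theorem neg_p_mul_nu_pos (h : D.IsFeasible gbar N) (hi : i < N) : 0 < -(D.p i * D.nu i) :=
  neg_pos.2 (mul_neg_of_pos_of_neg (h.p_pos i hi) (h.nu_neg hi))

theorem R_posDef (h : D.IsFeasible gbar N) (hi : i < N) : (D.R i).PosDef :=
  posDef_R (h.Pt_pos i hi) (h.rho_pos i hi)

theorem lamMax_pos (h : D.IsFeasible gbar N) (hi : i < N) : 0 < lamMax (D.R i) :=
  (lamMin_pos (h.R_posDef hi)).trans_le (lamMin_le_lamMax (h.R_posDef hi).isHermitian)

theorem mu_mul_pos (h : D.IsFeasible gbar N) (hi : i < N) : 0 < D.mu i * lamMin (D.R i) :=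
  Real.sqrt_pos.1 (h.delta_pos i hi)

/-- `Real.sqrt` vanishes at nonpositive arguments, so `δᵢ > 0` forces `μᵢ > 0`. -/
theorem one_lt (h : D.IsFeasible gbar N) (hi : i < N) : 1 < D.rho i + D.eps i := by
  have h1 := pos_of_mul_pos_left (h.mu_mul_pos hi) (lamMin_pos (h.R_posDef hi)).le
  rw [mu, div_pos_iff_of_pos_right (h.lamMax_pos hi)] at h1
  linarith

theorem delta_sq (h : D.IsFeasible gbar N) (hi : i < N) :
    D.delta i ^ 2 = (D.rho i + D.eps i - 1) * lamMin (D.R i) / lamMax (D.R i) := by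
  rw [delta, Real.sq_sqrt (h.mu_mul_pos hi).le, mu, div_mul_eq_mul_div]

theorem local_supply (h : D.IsFeasible gbar N) (hi : i < N) (x v : EuclideanSpace ℝ Idx) :
    2 * inner ℝ (euclOp (D.R i) x) (euclOp (matA + matB * D.Lbar i) x + v) ≤
      inner ℝ x v - D.rho i * ‖x‖ ^ 2 - D.nu i * ‖v‖ ^ 2 := by
  have := local_dissipation (h.Pt_pos i hi) (h.rho_pos i hi) (h.local_lmi i hi) x.ofLp v.ofLp
  rwa [norm_sq_eq_dotProduct, norm_sq_eq_dotProduct, inner_eq_dotProduct, inner_eq_dotProduct]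

theorem euclOp_K (h : D.IsFeasible gbar N) (hi : i < N) (j : ℕ) (x y : EuclideanSpace ℝ Idx) :
    inner ℝ (euclOp (D.R i) x) (euclOp (D.K i j) y) =
      (-(D.p i * D.nu i))⁻¹ * inner ℝ x (euclOp (D.R i * D.Q i j) y) := by
  have hK : D.K i j = (-(D.p i * D.nu i))⁻¹ • D.Q i j := by
    have hV : (D.Vp i)⁻¹ = (-(D.p i * D.nu i))⁻¹ • (1 : Matrix Idx Idx ℝ) := by
      refine Matrix.inv_eq_left_inv ?_
      rw [Vp, Matrix.smul_mul, Matrix.one_mul, smul_smul,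
        inv_mul_cancel₀ (h.neg_p_mul_nu_pos hi).ne', one_smul]
    rw [K, hV, Matrix.smul_mul, Matrix.one_mul]
  rw [inner_euclOp_comm (h.R_posDef hi).isHermitian, hK]
  simp only [euclOp, map_smul, smul_apply, real_inner_smul_right, map_mul, mul_apply_eq_comp]

theorem two_mul_inner_K_diag_le (h : D.IsFeasible gbar N) (hi : i < N)
    (x : EuclideanSpace ℝ Idx) :
    2 * inner ℝ (euclOp (D.R i) x) (euclOp (D.K i i) x) ≤ -D.eps i * ‖x‖ ^ 2 := by
  have h1 := inner_euclOp_self_nonneg (h.diag_bound i hi) x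
  rw [Matrix.inner_toEuclideanCLM, Matrix.sub_mulVec, dotProduct_sub, Matrix.smul_mulVec,
    Matrix.one_mulVec, dotProduct_smul, symPart, Matrix.add_mulVec, dotProduct_add,
    dotProduct_transpose_mulVec, dotProduct_comm (Matrix.mulVec _ _), smul_eq_mul,
    ← norm_sq_eq_dotProduct, ← Matrix.inner_toEuclideanCLM] at h1
  rw [h.euclOp_K hi]
  have hv := h.neg_p_mul_nu_pos hi
  rw [mul_left_comm, inv_mul_le_iff₀ hv]
  linarith

theorem inner_K_le (h : D.IsFeasible gbar N) (hi : i < N) {j : ℕ}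
    (hj : specNorm (D.R i * D.Q i j) / D.delta i ≤ -(D.p i * D.nu i) / 2 ^ (j + 1))
    (x y : EuclideanSpace ℝ Idx) :
    inner ℝ (euclOp (D.R i) x) (euclOp (D.K i j) y) ≤
      D.delta i * ‖x‖ * (‖y‖ / 2 ^ (j + 1)) := by
  rw [h.euclOp_K hi]
  have hv := h.neg_p_mul_nu_pos hi
  rw [inv_mul_le_iff₀ hv]
  rw [div_le_iff₀ (h.delta_pos i hi)] at hj
  calc inner ℝ x (euclOp (D.R i * D.Q i j) y) ≤ ‖x‖ * ‖euclOp (D.R i * D.Q i j) y‖ :=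
        real_inner_le_norm _ _
    _ ≤ ‖x‖ * (specNorm (D.R i * D.Q i j) * ‖y‖) := by
        gcongr; exact ContinuousLinearMap.le_opNorm _ _
    _ ≤ ‖x‖ * (-(D.p i * D.nu i) / 2 ^ (j + 1) * D.delta i * ‖y‖) := by gcongr
    _ = _ := by ring

/-- The derivative of the energy of agent `i` under the coupling bounds of its whole row. -/
theorem two_mul_inner_closedLoop_le (h : D.IsFeasible gbar N) (i : Fin N)
    (hj : ∀ j < N, j ≠ i →
      specNorm (D.R i * D.Q i j) / D.delta i ≤ -(D.p i * D.nu i) / 2 ^ (j + 1))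
    (x w : Stack N) :
    2 * inner ℝ (euclOp (D.R i) (x i)) (D.closedLoop N x w i) ≤
      -(D.rho i + D.eps i) * ‖x i‖ ^ 2 +
      2 * D.delta i * ‖x i‖ * ∑ j ∈ Finset.univ.erase i, ‖x j‖ / 2 ^ ((j : ℕ) + 1) +
      2 * inner ℝ (x i) (euclOp (D.R i) (w i)) := by
  -- With zero input the local dissipation gives the decay `-ρ|x|²` of the isolated agent; the
  -- diagonal gain adds `-ε|x|²`.
  have h1 := h.local_supply i.2 (x i) 0
  have h2 := h.two_mul_inner_K_diag_le i.2 (x i)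
  have h3 : ∑ j ∈ Finset.univ.erase i,
      inner ℝ (euclOp (D.R i) (x i)) (euclOp (D.K i j) (x j)) ≤
      D.delta i * ‖x i‖ * ∑ j ∈ Finset.univ.erase i, ‖x j‖ / 2 ^ ((j : ℕ) + 1) := by
    rw [Finset.mul_sum]
    refine Finset.sum_le_sum fun j hji => h.inner_K_le i.2 (hj j j.2 ?_) _ _
    exact fun hh => (Finset.mem_erase.1 hji).1 (Fin.ext hh)
  rw [closedLoop_apply, agentInput, ← Finset.add_sum_erase _ _ (Finset.mem_univ i),
    inner_add_right, inner_add_right, inner_add_right, inner_sum,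
    inner_euclOp_comm (h.R_posDef i.2).isHermitian (x i) (w i)]
  simp only [add_zero, inner_zero_right, norm_zero] at h1
  nlinarith

theorem sum_specNorm_lt (h : D.IsFeasible gbar N) (hi : i < N) :
    ∑ j ∈ Finset.range i, specNorm (D.R i * D.Q i j) < -(D.p i * D.nu i) * D.delta i :=
  sum_lt_of_dyadic_bound subset_rfl (h.delta_pos i hi) (h.neg_p_mul_nu_pos hi)
    fun j hj => h.coupling i hi j (Finset.mem_range.1 hj)

theorem coupling_of_ne (h : D.IsFeasible gbar N) (hb : D.BackwardCoupling N) (hi : i < N) {j : ℕ}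
    (hj : j < N) (hji : j ≠ i) :
    specNorm (D.R i * D.Q i j) / D.delta i ≤ -(D.p i * D.nu i) / 2 ^ (j + 1) :=
  hji.lt_or_gt.elim (h.coupling i hi j) (hb j hj i)

theorem sum_erase_specNorm_lt (h : D.IsFeasible gbar N) (hb : D.BackwardCoupling N)
    (hi : i < N) :
    ∑ j ∈ (Finset.range N).erase i, specNorm (D.R i * D.Q i j) <
      -(D.p i * D.nu i) * D.delta i :=
  sum_lt_of_dyadic_bound (Finset.erase_subset _ _) (h.delta_pos i hi) (h.neg_p_mul_nu_pos hi)
    fun _ hj => h.coupling_of_ne hb hi (Finset.mem_range.1 (Finset.mem_erase.1 hj).2)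
      (Finset.mem_erase.1 hj).1

/-- The trajectories of a network with the coupling bounds in all rows: the decay rate and the
gain depend only on the bounds on the spectra of the `R_i`. -/
theorem norm_sq_le_of_backwardCoupling (h : D.IsFeasible gbar N) (hb : D.BackwardCoupling N)
    {rmin rmax : ℝ} (hr : 0 < rmin) (hrm : 0 < rmax)
    (hR : ∀ i < N, rmin ≤ lamMin (D.R i) ∧ lamMax (D.R i) ≤ rmax)
    {w : ℝ → Stack N} {x₀ : Stack N} {x : ℝ → Stack N} (hx : IsSolution (D.closedLoop N) w x₀ x)
    {X W : ℝ} (hX : ∀ i, ‖x₀ i‖ ≤ X)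
    (hw : ∀ t, 0 ≤ t → ∀ i, ‖w t i‖ ≤ W) {t : ℝ} (ht : 0 ≤ t) (i : Fin N) :
    ‖x t i‖ ^ 2 ≤ 9 / 4 * (rmax / rmin) * X ^ 2 * Real.exp (-(7 / (72 * rmax) * t)) +
      81 / 2 * (rmax ^ 2 / rmin) / (7 / (72 * rmax)) * W ^ 2 := by
  -- Normalized so that `B j y y ≤ m` for all `j` implies `‖y j‖ ≤ weight j * √m`, the form in which
  -- the weighted row sums apply.
  set B : Fin N → Stack N →L[ℝ] Stack N →L[ℝ] ℝ := fun i =>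
    (lamMin (D.R i) * weight i ^ 2)⁻¹ • energy D i with hB
  have hpos : ∀ j : Fin N, 0 < lamMin (D.R j) * weight j ^ 2 := fun j =>
    mul_pos (lamMin_pos (h.R_posDef j.2)) (pow_pos (weight_pos j) 2)
  have hBapp : ∀ j y z, B j y z = (lamMin (D.R j) * weight j ^ 2)⁻¹ * energy D j y z :=
    fun j y z => rfl
  have hge : ∀ j (y : Stack N), ‖y j‖ ^ 2 ≤ weight j ^ 2 * B j y y := by
    intro j y
    have h1 := lamMin_mul_norm_sq_le (h.R_posDef j.2).isHermitian (y j)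
    rw [← energy_apply] at h1
    have h2 : weight j ^ 2 * B j y y = (lamMin (D.R j))⁻¹ * energy D j y y := by
      have := (weight_pos j).ne'
      rw [hBapp]; field_simp
    rwa [h2, le_inv_mul_iff₀ (lamMin_pos (h.R_posDef j.2))]
  have hwt : ∀ j : Fin N, 4 / 9 * rmin ≤ lamMin (D.R j) * weight j ^ 2 := fun j => by
    have h1 := (hR j j.2).1
    have h2 := two_thirds_le_weight j
    nlinarith [weight_pos j, mul_le_mul h1 (pow_le_pow_left₀ (by norm_num) h2 2) (by norm_num)
      (hr.le.trans h1)]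
  -- The rate comes from `8/9 - 25/36 = 7/36` and `(ρ + ε) / (2 λ_max) ≥ 1 / (2 rmax)`. The factors
  -- `9/4` and `81/2 = 18 * 9/4` come from `weight² ≥ 4/9`.
  have key := quadratic_le_of_max_dissipation hx B (P := fun v => ∀ i, ‖v i‖ ≤ W) hw
    (a := fun i => 25 / 36 * ((D.rho i + D.eps i) / (2 * lamMax (D.R i))))
    (b := fun i => 8 / 9 * ((D.rho i + D.eps i) / (2 * lamMax (D.R i))))
    (α := 7 / (72 * rmax)) (κ := 81 / 2 * (rmax ^ 2 / rmin) * W ^ 2)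
    (c := 9 / 4 * (rmax / rmin) * X ^ 2) (by positivity) (by positivity) (by positivity)
    (fun i => by
      have h1 : 1 / (2 * rmax) ≤ (D.rho i + D.eps i) / (2 * lamMax (D.R i)) := by
        have := (hR i i.2).2
        have := h.one_lt i.2
        have := h.lamMax_pos i.2
        gcongr
      have h2 : 7 / (72 * rmax) = 7 / 36 * (1 / (2 * rmax)) := by field_simp; norm_num
      rw [h2]
      linarith)
    (fun y v hv i m hm => by
      have hm0 : 0 ≤ m := by
        refine le_trans ?_ (hm i)
        have h1 := hge i y
        have h2 : 0 < weight i ^ 2 := pow_pos (weight_pos i) 2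
        exact nonneg_of_mul_nonneg_right ((sq_nonneg _).trans h1) h2
      have hS := sum_erase_div_le i (y := fun j => ‖y j‖) (Real.sqrt_nonneg m) fun j => by
        refine le_of_abs_le (abs_le_of_sq_le_sq ?_
          (mul_nonneg (weight_pos j).le (Real.sqrt_nonneg m)))
        rw [mul_pow, Real.sq_sqrt hm0]
        exact (hge j y).trans (mul_le_mul_of_nonneg_left (hm j) (sq_nonneg _))
      have hc := h.one_lt i.2
      have hmax := h.lamMax_pos i.2
      have h1 := agent_decay (c := D.rho i + D.eps i) (V := energy D i y y)
        (dV := energy D i y (D.closedLoop N y v) + energy D i (D.closedLoop N y v) y)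
        hc (lamMin_pos (h.R_posDef i.2)) hmax (h.delta_pos i i.2).le (h.delta_sq i.2)
        (norm_nonneg (y i)) (weight_pos i) hm0 hS
        (inner_euclOp_le_lamMax (h.R_posDef i.2).isHermitian (y i))
        (by
          rw [energy_add_energy (h.R_posDef i.2).isHermitian]
          exact h.two_mul_inner_closedLoop_le i (fun j hj hji => h.coupling_of_ne hb i.2 hj hji)
            y v)
        (two_mul_inner_euclOp_le (h.R_posDef i.2).posSemidef (by positivity) (y i) (v i))
        ((inner_euclOp_le_lamMax (h.R_posDef i.2).isHermitian (v i)).trans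
          (mul_le_mul_of_nonneg_left (pow_le_pow_left₀ (norm_nonneg _) (hv i) 2) hmax.le))
      rw [hBapp, hBapp, hBapp, ← mul_add]
      refine h1.trans (add_le_add_right ?_ _)
      have h2 : 1 * (4 / 9 * rmin) ≤
          (D.rho i + D.eps i) * (lamMin (D.R i) * weight i ^ 2) :=
        mul_le_mul hc.le (hwt i) (by positivity) (by linarith)
      calc 18 * lamMax (D.R i) ^ 2 * W ^ 2 /
            ((D.rho i + D.eps i) * (lamMin (D.R i) * weight i ^ 2))
          ≤ 18 * rmax ^ 2 * W ^ 2 / (1 * (4 / 9 * rmin)) := by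
            have := (hR i i.2).2
            gcongr
        _ = 81 / 2 * (rmax ^ 2 / rmin) * W ^ 2 := by field_simp; ring)
    (fun i => by
      rw [hBapp, inv_mul_le_iff₀ (hpos i)]
      have h1 := inner_euclOp_le_lamMax (h.R_posDef i.2).isHermitian (x₀ i)
      rw [← energy_apply] at h1
      calc energy D i x₀ x₀ ≤ lamMax (D.R i) * ‖x₀ i‖ ^ 2 := h1
        _ ≤ rmax * X ^ 2 := by
          have := (hR i i.2).2
          have := hX i
          gcongr
        _ = 4 / 9 * rmin * (9 / 4 * (rmax / rmin) * X ^ 2) := by field_simp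
        _ ≤ _ := mul_le_mul_of_nonneg_right (hwt i) (by positivity))
    ht i
  refine (hge i (x t)).trans ((mul_le_of_le_one_left ?_ ?_).trans (key.trans_eq ?_))
  · exact nonneg_of_mul_nonneg_right ((sq_nonneg _).trans (hge i (x t))) (pow_pos (weight_pos i) 2)
  · exact pow_le_one₀ (weight_pos i).le (weight_le_one i)
  · ring

/-- The weighted sum of the energies of the agents. -/
def totalEnergy (D : Design) (N : ℕ) : Stack N →L[ℝ] Stack N →L[ℝ] ℝ :=
  ∑ i : Fin N, D.p i • energy D i

theorem totalEnergy_apply (D : Design) (N : ℕ) (x y : Stack N) :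
    totalEnergy D N x y = ∑ i : Fin N, D.p i * energy D i x y := by
  simp [totalEnergy]

theorem totalEnergy_dissipation (h : D.IsFeasible gbar N) {γ : ℝ}
    (hγ : ∀ i < N, D.gamHat i ≤ γ ^ 2) (x w : Stack N) :
    totalEnergy D N x (D.closedLoop N x w) + totalEnergy D N (D.closedLoop N x w) x ≤
      γ ^ 2 * ‖w‖ ^ 2 - ‖x‖ ^ 2 := by
  -- The block form is indexed by `ℕ`, so stacked vectors are extended by zero.
  let ext : (Fin N → EuclideanSpace ℝ Idx) → ℕ → Idx → ℝ := fun y k =>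
    if hk : k < N then (y ⟨k, hk⟩).ofLp else 0
  have hext : ∀ y (j : Fin N), ext y j = (y j).ofLp := fun y j => by simp [ext]
  have h1 := sum_supply_le (N := N) (fun i hi => h.nu_neg hi) h.p_pos h.tilde_pos
    (ext x) (ext w) (ext (agentInput D x w)) (fun k hk => by
      rw [Finset.sum_range]
      have := hext (agentInput D x w) ⟨k, hk⟩
      simp only at this
      rw [this, show ext w k = _ from hext w ⟨k, hk⟩]
      simp [agentInput, hext])
  rw [Finset.sum_range, Finset.sum_range] at h1
  simp only [hext, ← norm_sq_eq_dotProduct, ← inner_eq_dotProduct] at h1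
  rw [totalEnergy_apply, totalEnergy_apply, ← Finset.sum_add_distrib, PiLp.norm_sq_eq_of_L2,
    PiLp.norm_sq_eq_of_L2, Finset.mul_sum, ← Finset.sum_sub_distrib]
  refine le_trans (Finset.sum_le_sum fun i _ => ?_) (h1.trans (Finset.sum_le_sum fun i _ => ?_))
  · rw [← mul_add, energy_add_energy (h.R_posDef i.2).isHermitian, closedLoop_apply]
    exact mul_le_mul_of_nonneg_left (h.local_supply i.2 _ _) (h.p_pos i i.2).le
  · have := mul_le_mul_of_nonneg_right (hγ i i.2) (sq_nonneg ‖w i‖)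
    linarith

theorem exists_totalEnergy_bounds (h : D.IsFeasible gbar N) (hN : 0 < N) :
    ∃ l L : ℝ, 0 < l ∧ 0 < L ∧ ∀ y : Stack N,
      l * ‖y‖ ^ 2 ≤ totalEnergy D N y y ∧ totalEnergy D N y y ≤ L * ‖y‖ ^ 2 := by
  have : Nonempty (Fin N) := ⟨⟨0, hN⟩⟩
  obtain ⟨i, hi⟩ := Finite.exists_min fun i : Fin N => D.p i * lamMin (D.R i)
  obtain ⟨j, hj⟩ := Finite.exists_max fun i : Fin N => D.p i * lamMax (D.R i)
  refine ⟨_, _, mul_pos (h.p_pos i i.2) (lamMin_pos (h.R_posDef i.2)),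
    mul_pos (h.p_pos j j.2) (h.lamMax_pos j.2), fun y => ?_⟩
  rw [totalEnergy_apply, PiLp.norm_sq_eq_of_L2, Finset.mul_sum, Finset.mul_sum]
  refine ⟨Finset.sum_le_sum fun k _ => ?_, Finset.sum_le_sum fun k _ => ?_⟩
  · refine (mul_le_mul_of_nonneg_right (hi k) (sq_nonneg _)).trans ?_
    rw [mul_assoc]
    exact mul_le_mul_of_nonneg_left
      (lamMin_mul_norm_sq_le (h.R_posDef k.2).isHermitian (y k)) (h.p_pos k k.2).le
  · refine le_trans ?_ (mul_le_mul_of_nonneg_right (hj k) (sq_nonneg _))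
    rw [mul_assoc]
    exact mul_le_mul_of_nonneg_left
      (inner_euclOp_le_lamMax (h.R_posDef k.2).isHermitian (y k)) (h.p_pos k k.2).le

theorem exists_gain (h : D.IsFeasible gbar N) (hN : 0 < N) :
    ∃ γ : ℝ, 0 < γ ∧ γ ^ 2 < gbar ∧ ∀ i < N, D.gamHat i ≤ γ ^ 2 := by
  have : Nonempty (Fin N) := ⟨⟨0, hN⟩⟩
  obtain ⟨j, hj⟩ := Finite.exists_max fun i : Fin N => D.gamHat i
  have hpos : 0 < D.gamHat j := gamHat_pos fun k hk => h.tilde_pos k (hk.trans_lt j.2)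
  refine ⟨Real.sqrt (D.gamHat j), Real.sqrt_pos.2 hpos, ?_, fun i hi => ?_⟩
  · rw [Real.sq_sqrt hpos.le]; exact h.gamHat_lt j j.2
  · rw [Real.sq_sqrt hpos.le]; exact hj ⟨i, hi⟩

theorem exists_isL2G_hasL2Gain (h : D.IsFeasible gbar N) (hN : 0 < N) :
    ∃ γ : ℝ, 0 < γ ∧ γ ^ 2 < gbar ∧ IsL2G (D.closedLoop N) output γ ∧
      HasL2Gain (D.closedLoop N) output γ := by
  obtain ⟨γ, hγ, hγg, hle⟩ := h.exists_gain hN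
  obtain ⟨l, L, hl, hL, hlL⟩ := h.exists_totalEnergy_bounds hN
  have hdis := h.totalEnergy_dissipation hle
  refine ⟨γ, hγ, hγg, ?_, ?_⟩
  · refine isL2G_of_quadratic (totalEnergy D N) (D.closedLoop_add N) (fun y hy => ?_) hdis
    have := norm_pos_iff.2 hy
    exact (by positivity : 0 < l * ‖y‖ ^ 2).trans_le (hlL y).1
  · exact hasL2Gain_of_quadratic hγ.le (totalEnergy D N)
      (fun y => (by positivity : 0 ≤ l * ‖y‖ ^ 2).trans (hlL y).1) hdis

/-- The term `-|x|²` dominates `-V / L` for the total energy `V`, which gives exponential decay.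
Passing from the maximum over agents to the Euclidean norm costs a factor `N`, and `l`, `L` depend
on the weights `pᵢ`, so the constants are not uniform. -/
theorem isScalableMeshStable_singleton (h : D.IsFeasible gbar N) (hN : 0 < N) :
    IsScalableMeshStable {D.network N} := by
  obtain ⟨γ, hγ, -, hle⟩ := h.exists_gain hN
  obtain ⟨l, L, hl, hL, hlL⟩ := h.exists_totalEnergy_bounds hN
  have hN' : (0 : ℝ) < N := by exact_mod_cast hN
  have hsq : ∀ (y : Stack N) (M : ℝ), (∀ i, ‖y i‖ ≤ M) → ‖y‖ ^ 2 ≤ N * M ^ 2 := by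
    intro y M hM
    rw [PiLp.norm_sq_eq_of_L2]
    refine (Finset.sum_le_card_nsmul Finset.univ _ (M ^ 2) fun i _ =>
      pow_le_pow_left₀ (norm_nonneg _) (hM i) 2).trans_eq ?_
    simp
  have hdis : ∀ (y v : Stack N) (W : ℝ), (∀ i, ‖v i‖ ≤ W) → ∀ m : ℝ,
      totalEnergy D N y (D.closedLoop N y v) + totalEnergy D N (D.closedLoop N y v) y ≤
        -(1 / L) * totalEnergy D N y y + 0 * m + γ ^ 2 * (N * W ^ 2) := by
    intro y v W hv m
    have h1 := h.totalEnergy_dissipation hle y v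
    have h2 := mul_le_mul_of_nonneg_left (hsq v W hv) (sq_nonneg γ)
    have h3 : 1 / L * totalEnergy D N y y ≤ ‖y‖ ^ 2 := by
      rw [one_div, inv_mul_le_iff₀ hL]; exact (hlL y).2
    linarith
  refine isScalableMeshStable_of_exp_bound (C := Real.sqrt (L * N / l))
    (G := Real.sqrt (γ ^ 2 * N * L / l)) (α := 1 / L / 2) (by positivity) (by positivity)
    (by positivity) ?_ ?_
  · rintro _ rfl w x₀ hw
    exact exists_solution (D.closedLoop_add N) (D.closedLoop_smul N) (D.closedLoop_zero_left N)
      w x₀ hw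
  · rintro _ rfl w x₀ x hx X W hX hW hX0 hw t ht i
    refine le_of_sq_le_exp (by positivity) (by positivity) hX hW ?_
    have key := quadratic_le_of_max_dissipation hx (ι := Unit) (fun _ => totalEnergy D N)
      (P := fun v => ∀ i, ‖v i‖ ≤ W) hw (a := fun _ => 0) (b := fun _ => 1 / L) (α := 1 / L)
      (κ := γ ^ 2 * (N * W ^ 2)) (c := L * (N * X ^ 2)) (by positivity) (by positivity)
      (by positivity) (fun _ => by simp)
      (fun y v hv _ m _ => hdis y v W hv m)
      (fun _ => (hlL x₀).2.trans (mul_le_mul_of_nonneg_left (hsq x₀ X hX0) hL.le)) ht ()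
    have h1 : ‖x t i‖ ^ 2 ≤ ‖x t‖ ^ 2 :=
      pow_le_pow_left₀ (norm_nonneg _) (PiLp.norm_apply_le (x t) i) 2
    have h2 := (hlL (x t)).1.trans key
    rw [← le_div_iff₀' hl] at h2
    refine (h1.trans h2).trans_eq ?_
    field_simp

end IsFeasible

theorem isScalableMeshStable_setOf {rmin rmax : ℝ} (hr : 0 < rmin) :
    IsScalableMeshStable
      {net | ∃ (gbar : ℝ) (N : ℕ) (D : Design),
        D.IsFeasible gbar N ∧ D.BackwardCoupling N ∧
        (∀ i < N, rmin ≤ lamMin (D.R i) ∧ lamMax (D.R i) ≤ rmax) ∧ net = D.network N} := by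
  -- `rmax` may be nonpositive: the spectral bounds are vacuous for the empty network. The maximum
  -- keeps all constants positive.
  have hM : 0 < max rmin rmax := hr.trans_le (le_max_left _ _)
  refine isScalableMeshStable_of_exp_bound
    (C := Real.sqrt (9 / 4 * (max rmin rmax / rmin)))
    (G := Real.sqrt (81 / 2 * (max rmin rmax ^ 2 / rmin) / (7 / (72 * max rmin rmax))))
    (α := 7 / (72 * max rmin rmax) / 2) (by positivity) (by positivity) (by positivity) ?_ ?_
  · rintro _ ⟨gbar, N, D, h, hb, hR, rfl⟩ w x₀ hw
    exact exists_solution (D.closedLoop_add N) (D.closedLoop_smul N) (D.closedLoop_zero_left N)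
      w x₀ hw
  · rintro _ ⟨gbar, N, D, h, hb, hR, rfl⟩ w x₀ x hx X W hX hW hX0 hw t ht i
    exact le_of_sq_le_exp (by positivity) (by positivity) hX hW
      (h.norm_sq_le_of_backwardCoupling hb hr hM
        (fun i hi => ⟨(hR i hi).1, (hR i hi).2.trans (le_max_right _ _)⟩) hx hX0 hw ht i)

end Design

end RigidBodyNetwork

end

theorem theorem3 :
    -- every network of agents that solved their local problems
    (∀ (gbar : ℝ) (N : ℕ) (D : RigidBodyNetwork.Design), 0 < N → D.IsFeasible gbar N →
      (∃ γ : ℝ, 0 < γ ∧ γ ^ 2 < gbar ∧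
        RigidBodyNetwork.IsL2G (D.closedLoop N) RigidBodyNetwork.output γ ∧
        RigidBodyNetwork.HasL2Gain (D.closedLoop N) RigidBodyNetwork.output γ) ∧
      (∀ i < N, ∑ j ∈ Finset.range i, RigidBodyNetwork.specNorm (D.R i * D.Q i j) <
        -(D.p i * D.nu i) * D.delta i) ∧
      RigidBodyNetwork.IsScalableMeshStable {D.network N}) ∧
    -- the coupling bounds in all rows imply the centralized mesh stability condition
    (∀ (gbar : ℝ) (N : ℕ) (D : RigidBodyNetwork.Design), D.IsFeasible gbar N →
      D.BackwardCoupling N →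
      ∀ i < N, ∑ j ∈ (Finset.range N).erase i, RigidBodyNetwork.specNorm (D.R i * D.Q i j) <
        -(D.p i * D.nu i) * D.delta i) ∧
    -- and mesh stability with constants that do not depend on the number of agents
    (∀ rmin rmax : ℝ, 0 < rmin →
      RigidBodyNetwork.IsScalableMeshStable
        {net | ∃ (gbar : ℝ) (N : ℕ) (D : RigidBodyNetwork.Design),
          D.IsFeasible gbar N ∧ D.BackwardCoupling N ∧
          (∀ i < N, rmin ≤ RigidBodyNetwork.lamMin (D.R i) ∧
            RigidBodyNetwork.lamMax (D.R i) ≤ rmax) ∧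
          net = D.network N}) :=
  ⟨fun _ _ _ hN h => ⟨h.exists_isL2G_hasL2Gain hN, fun _ hi => h.sum_specNorm_lt hi,
      h.isScalableMeshStable_singleton hN⟩,
    fun _ _ _ h hb _ hi => h.sum_erase_specNorm_lt hb hi,
    fun _ _ hr => RigidBodyNetwork.Design.isScalableMeshStable_setOf hr⟩
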